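/- Let $n,m\in\mathbb{N}$ and let $\mathbb{R}^n,\mathbb{R}^m$ be equipped with arbitrary norms $\|\cdot\|$. Consider the system $$\dot x(t)=f(x(t))+g(x(t))u(t),\qquad y(t)=h(x(t)),\qquad(1)$$ with $f\in C^1(\mathbb{R}^n,\mathbb{R}^n)$, $g\in C^1(\mathbb{R}^n,\mathbb{R}^{n\times m})$, $h\in C^2(\mathbb{R}^n,\mathbb{R}^m)$. Solutions are Carathéodory solutions (absolutely continuous on compact intervals, differential equation satisfied almost everywhere); a global solution on $[a,\infty)$ is one that is a solution on $[a,b]$ for every $b>a$. For $u\in L^\infty([a,b],\mathbb{R}^m)$ let $x(\cdot;a,x^0,u)$ be the unique maximal solution of (1) with $x(a)=x^0$. Assume that the system belongs to the class $\mathcal{N}^m$, i.e. * the matrix $\Gamma(x)=h'(x)g(x)$ is invertible for all $x\in\mathbb{R}^n$; * the distribution $x\mapsto\operatorname{im}g(x)$ is involutive: for all smooth vector fields $\psi_1,\psi_2$ on $\mathbb{R}^n$ with values $\psi_i(x)\in\operatorname{im}g(x)$ the Lie bracket satisfies $[\psi_1,\psi_2](x)\in\operatorname{im}g(x)$ for all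 $x$; * there is a diffeomorphism $\Phi:\mathbb{R}^n\to\mathbb{R}^m\times\mathbb{R}^{n-m}$, $\Phi(x)=(y,\eta)$ with $y=h(x)$, which transforms (1) into the Byrnes–Isidori form $\dot y=p(y,\eta)+\Gamma(\Phi^{-1}(y,\eta))u$, $\dot\eta=q(y,\eta)$ with $p,q\in C^1$, and which has the following BIBS property: for every $c_0>0$ there is $c_1>0$ such that for all $t^0\ge 0$, $\eta^0\in\mathbb{R}^{n-m}$ and $y\in L^\infty_{\rm loc}([t^0,\infty),\mathbb{R}^m)$ with $\|\eta^0\|+\|y\|_\infty\le c_0$ the solution of $\dot\eta=q(y,\eta)$, $\eta(t^0)=\eta^0$, is global and bounded by $c_1$ on $[t^0,\infty)$. Let $\varphi\in W^{1,\infty}([0,\infty),\mathbb{R})$ with $\inf_{t\ge0}\varphi(t)>0$, let $y_{\rm ref}\in W^{1,\infty}([0,\infty),\mathbb{R}^m)$ (both identified with their continuous representatives), let $t^0\ge0$, and let $B\subset\{x\in\mathbb{R}^n:\varphi(t^0)\|h(x)-y_{\rm ref}(t^0)\|<1\}$ be bounded. For $\lambda_u\ge0$ define the stage cost $$\ell_\varphi(t,x,u)=\begin{cases}\dfrac{1}{1-\varphi(t)^2\|h(x)-y_{\rm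 ref}(t)\|^2}-1+\lambda_u\|u\|^2,&\varphi(t)\|h(x)-y_{\rm ref}(t)\|\ne1,\\ \infty,&\text{else.}\end{cases}$$ For $M,T>0$, $\hat t\ge0$ and $\hat x\in\mathbb{R}^n$ the optimal control problem $\mathrm{OCP}(\hat t,\hat x)$ is to minimize $$J(u)=\int_{\hat t}^{\hat t+T}\ell_\varphi\big(t,x(t;\hat t,\hat x,u),u(t)\big)\,dt$$ over all $u\in L^\infty([\hat t,\hat t+T],\mathbb{R}^m)$ with $\|u\|_\infty\le M$. Here $J(u)=\infty$ if $x(\cdot;\hat t,\hat x,u)$ does not exist on all of $[\hat t,\hat t+T]$ or if the integrals of the positive and of the negative part of the integrand are both infinite. The Funnel MPC algorithm with parameters $M>0$, time shift $\delta>0$ and prediction horizon $T\ge\delta$, started at $x(t^0)=x^0$, does the following at each time $\hat t=t^0+k\delta$, $k=0,1,2,\dots$: it computes a minimizer $u^\star$ of $\mathrm{OCP}(\hat t,x(\hat t))$ and applies the input $u_{\rm FMPC}(t)=u^\star(t)$, $t\in[\hat t,\hat t+\delta)$, to (1). **Theorem.** There exists $M>0$, depending only on the system, $\varphi$, $y_{\rm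 ref}$, $t^0$ and $B$, such that for all $\lambda_u\ge0$, all $\delta>0$, all $T\ge\delta$ and all $x^0\in B$ the following holds. * Initial and recursive feasibility: $\mathrm{OCP}(t^0,x^0)$ has a minimizer with cost $J<\infty$; and after any $N\in\mathbb{N}$ steps of the algorithm, for any choice of minimizers in these steps, $\mathrm{OCP}(t^0+N\delta,x(t^0+N\delta))$ has a minimizer with cost $J<\infty$. * The closed loop of (1) and the algorithm has a (not necessarily unique) global solution $x:[t^0,\infty)\to\mathbb{R}^n$. * Every global solution $x$ of the closed loop, with corresponding input $u_{\rm FMPC}$, satisfies (i) $\|u_{\rm FMPC}(t)\|\le M$ for almost all $t\ge t^0$, and (ii) the error $e(t)=h(x(t))-y_{\rm ref}(t)$ evolves within the funnel: $\varphi(t)\|e(t)\|<1$, in particular $\|e(t)\|\le 1/\varphi(t)$, for all $t\ge t^0$. -/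

import Mathlib

open MeasureTheory Set Topology
open scoped ContDiff

noncomputable section

namespace FunnelMPC

/-! ### Function spaces on the half line -/

section Functions

variable {E : Type*} [NormedAddCommGroup E] [NormedSpace ℝ E] [FiniteDimensional ℝ E]

/-- `w` is a weak derivative of `v` on the open half line `(0, ∞)`:
`∫ ψ' v = - ∫ ψ w` for all smooth `ψ` with compact support in `(0, ∞)`. -/
def IsWeakDeriv (v w : ℝ → E) : Prop :=
  ∀ ψ : ℝ → ℝ, ContDiff ℝ ∞ ψ → HasCompactSupport ψ → tsupport ψ ⊆ Ioi 0 →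
    ∫ t in Ioi (0 : ℝ), deriv ψ t • v t = - ∫ t in Ioi (0 : ℝ), ψ t • w t

/-- The Sobolev space `W^{1,∞}([0, ∞), E)`: essentially bounded functions with an essentially
bounded weak derivative. As usual an element is represented by its continuous representative
(pointwise values are used below). Values at negative times are irrelevant. -/
def MemW1Infty (v : ℝ → E) : Prop :=
  ContinuousOn v (Ici 0) ∧ MemLp v ⊤ (volume.restrict (Ioi (0 : ℝ))) ∧
    ∃ w : ℝ → E, MemLp w ⊤ (volume.restrict (Ioi (0 : ℝ))) ∧ IsWeakDeriv v w

/-- The set of funnel functions: `φ ∈ W^{1,∞}([0, ∞), ℝ)` with `inf_{t ≥ 0} φ(t) > 0`. -/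
def funnelFunctions : Set (ℝ → ℝ) :=
  {φ | MemW1Infty φ ∧ ∃ c : ℝ, 0 < c ∧ ∀ t : ℝ, 0 ≤ t → c ≤ φ t}

/-- The performance funnel `{(t, e) | t ≥ 0, φ(t) ‖e‖ < 1}`. -/
def funnel (E : Type*) [NormedAddCommGroup E] (φ : ℝ → ℝ) : Set (ℝ × E) :=
  {p | 0 ≤ p.1 ∧ φ p.1 * ‖p.2‖ < 1}

/-! ### Carathéodory solutions -/

/-- `x` is a Carathéodory solution on the compact interval `[a, b]` of the initial value problem
`x'(t) = F(t, x(t))`, `x(a) = x₀`. -/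
def IsSolutionOn (F : ℝ → E → E) (a b : ℝ) (x₀ : E) (x : ℝ → E) : Prop :=
  x a = x₀ ∧ AbsolutelyContinuousOnInterval x a b ∧
    ∀ᵐ t ∂(volume.restrict (Ioo a b)), HasDerivAt x (F t (x t)) t

/-- `x` is a global Carathéodory solution, i.e. a solution on `[a, b]` for all `b > a`. -/
def IsGlobalSolution (F : ℝ → E → E) (a : ℝ) (x₀ : E) (x : ℝ → E) : Prop :=
  ∀ b : ℝ, a < b → IsSolutionOn F a b x₀ x

end Functions

/-! ### Integrals of extended real valued functions -/

/-- `ζ` is quasi-integrable: it is (a.e.) measurable and at least one of the integrals of its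
positive and negative parts is finite. -/
def QuasiIntegrable (ζ : ℝ → EReal) (μ : Measure ℝ) : Prop :=
  AEMeasurable ζ μ ∧ (∫⁻ t, (ζ t).toENNReal ∂μ ≠ ⊤ ∨ ∫⁻ t, (-ζ t).toENNReal ∂μ ≠ ⊤)

/-- The Lebesgue integral `∫ ζ⁺ - ∫ ζ⁻` of a quasi-integrable function. -/
def extIntegral (ζ : ℝ → EReal) (μ : Measure ℝ) : EReal :=
  ((∫⁻ t, (ζ t).toENNReal ∂μ : ENNReal) : EReal) - ((∫⁻ t, (-ζ t).toENNReal ∂μ : ENNReal) : EReal)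

/-! ### Control systems -/

/-- A control affine system `x' = f(x) + g(x) u`, `y = h(x)` with state space `X`, and with input
and output in the same space `Y`. Finite-dimensional normed spaces `X`, `Y` stand for `ℝⁿ`, `ℝᵐ`
with an arbitrary choice of norms. -/
structure ControlSystem (X Y : Type*) [NormedAddCommGroup X] [NormedSpace ℝ X]
    [NormedAddCommGroup Y] [NormedSpace ℝ Y] where
  f : X → X
  g : X → (Y →L[ℝ] X)
  h : X → Y
  contDiff_f : ContDiff ℝ 1 f
  contDiff_g : ContDiff ℝ 1 g
  contDiff_h : ContDiff ℝ 2 h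

namespace ControlSystem

variable {X Y : Type*}
  [NormedAddCommGroup X] [NormedSpace ℝ X] [FiniteDimensional ℝ X]
  [NormedAddCommGroup Y] [NormedSpace ℝ Y] [FiniteDimensional ℝ Y]

/-- The right-hand side `(t, x) ↦ f(x) + g(x) u(t)` under the input `u`. -/
def rhs (S : ControlSystem X Y) (u : ℝ → Y) (t : ℝ) (x : X) : X :=
  S.f x + S.g x (u t)

/-! #### The system class -/

/-- The high-frequency gain matrix `Γ(x) = h'(x) g(x)`. -/
def gain (S : ControlSystem X Y) (x : X) : Y →L[ℝ] Y :=
  (fderiv ℝ S.h x).comp (S.g x)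

/-- The distribution `x ↦ im g(x)` is involutive. -/
def IsInvolutive (S : ControlSystem X Y) : Prop :=
  ∀ ψ₁ ψ₂ : X → X, ContDiff ℝ ∞ ψ₁ → ContDiff ℝ ∞ ψ₂ →
    (∀ x, ψ₁ x ∈ range (S.g x)) → (∀ x, ψ₂ x ∈ range (S.g x)) →
    ∀ x, VectorField.lieBracket ℝ ψ₁ ψ₂ x ∈ range (S.g x)

/-- The space `ℝ^{n-m}` of the internal variable, where `n = dim X` and `m = dim Y`. (If the gain
matrix is invertible then `m ≤ n`, so the subtraction is not truncated.) -/
abbrev Internal (X Y : Type*) [NormedAddCommGroup X] [NormedSpace ℝ X]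
    [NormedAddCommGroup Y] [NormedSpace ℝ Y] : Type :=
  EuclideanSpace ℝ (Fin (Module.finrank ℝ X - Module.finrank ℝ Y))

/-- The diffeomorphism `(y, η) = Φ(x)` of the state space onto `ℝᵐ × ℝ^{n-m}`, whose first
component is the output, puts the system into the Byrnes-Isidori form
`y' = p(y, η) + Γ(Φ⁻¹(y, η)) u`, `η' = q(y, η)`. -/
structure IsByrnesIsidoriForm (S : ControlSystem X Y) (Φ : X ≃ Y × Internal X Y)
    (p : Y × Internal X Y → Y) (q : Y × Internal X Y → Internal X Y) : Prop where
  contDiff_Φ : ContDiff ℝ 1 Φ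
  contDiff_Φ_symm : ContDiff ℝ 1 Φ.symm
  contDiff_p : ContDiff ℝ 1 p
  contDiff_q : ContDiff ℝ 1 q
  fst_eq_output : ∀ x, (Φ x).1 = S.h x
  transform : ∀ (x : X) (v : Y),
    fderiv ℝ Φ x (S.f x + S.g x v) = (p (Φ x) + S.gain x v, q (Φ x))

/-- The bounded-input, bounded-state condition on the internal dynamics `η' = q(y, η)`: for all
`c₀ > 0` there is `c₁ > 0` such that for all `t₀ ≥ 0`, `η₀` and all measurable `y` on `[t₀, ∞)`
with `‖η₀‖ + ‖y‖_∞ ≤ c₀` the initial value problem has a global solution, and it is bounded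
by `c₁`. (Since `q` is continuously differentiable, the solution is unique.) -/
def IsBIBS (q : Y × Internal X Y → Internal X Y) : Prop :=
  ∀ c₀ : ℝ, 0 < c₀ → ∃ c₁ : ℝ, 0 < c₁ ∧
    ∀ (t₀ : ℝ) (η₀ : Internal X Y) (y : ℝ → Y), 0 ≤ t₀ →
      AEStronglyMeasurable y (volume.restrict (Ici t₀)) →
      ‖η₀‖ₑ + eLpNorm y ⊤ (volume.restrict (Ici t₀)) ≤ ENNReal.ofReal c₀ →
      ∃ η : ℝ → Internal X Y,
        IsGlobalSolution (fun t z => q (y t, z)) t₀ η₀ η ∧ ∀ t, t₀ ≤ t → ‖η t‖ ≤ c₁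

/-- The system class: global relative degree one, involutive `im g`, and internal dynamics (of a
global Byrnes-Isidori form) with the bounded-input, bounded-state property. The latter property
does not depend on the choice of the Byrnes-Isidori form. -/
structure MemClassN (S : ControlSystem X Y) : Prop where
  relDegreeOne : ∀ x, IsUnit (S.gain x)
  involutive : S.IsInvolutive
  bibs : ∃ Φ p q, S.IsByrnesIsidoriForm Φ p q ∧ IsBIBS (X := X) (Y := Y) q

/-! #### The optimal control problem -/

variable (S : ControlSystem X Y) (φ : ℝ → ℝ) (yref : ℝ → Y)

/-- The states whose output lies inside the funnel at time `t`:
`φ(t) ‖h(x) - y_ref(t)‖ < 1`. -/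
def funnelStates (t : ℝ) : Set X :=
  {x | φ t * ‖S.h x - yref t‖ < 1}

open Classical in
/-- The stage cost `ℓ_φ(t, x, v)` with design parameter `lam`. -/
def stageCost (lam : ℝ) (t : ℝ) (x : X) (v : Y) : EReal :=
  if φ t * ‖S.h x - yref t‖ ≠ 1 then
    ((1 / (1 - φ t ^ 2 * ‖S.h x - yref t‖ ^ 2) - 1 + lam * ‖v‖ ^ 2 : ℝ) : EReal)
  else ⊤

open Classical in
/-- The response `x(·; a, x₀, u)` on `[a, b]`, if there is a solution on all of `[a, b]` (it is
then unique on `[a, b]`), and zero otherwise. -/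
def response (a b : ℝ) (x₀ : X) (u : ℝ → Y) : ℝ → X :=
  if hx : ∃ x, IsSolutionOn (S.rhs u) a b x₀ x then hx.choose else 0

open Classical in
/-- The cost functional on `[a, a + T]`: the integral of the stage cost along the response, and
`∞` if the response does not exist on `[a, a + T]` or if the stage cost along it is not
quasi-integrable. -/
def cost (lam T a : ℝ) (x₀ : X) (u : ℝ → Y) : EReal :=
  if (∃ x, IsSolutionOn (S.rhs u) a (a + T) x₀ x) ∧
      QuasiIntegrable (fun t => S.stageCost φ yref lam t (S.response a (a + T) x₀ u t) (u t))
        (volume.restrict (Icc a (a + T))) then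
    extIntegral (fun t => S.stageCost φ yref lam t (S.response a (a + T) x₀ u t) (u t))
      (volume.restrict (Icc a (a + T)))
  else ⊤

/-- The admissible controls: `u ∈ L^∞([a, a + T], Y)` with `‖u‖_∞ ≤ M`. -/
def IsAdmissible (Y : Type*) [NormedAddCommGroup Y] (M T a : ℝ) (u : ℝ → Y) : Prop :=
  MemLp u ⊤ (volume.restrict (Icc a (a + T))) ∧
    eLpNorm u ⊤ (volume.restrict (Icc a (a + T))) ≤ ENNReal.ofReal M

/-- `u` is an admissible control that minimizes the cost functional on `[a, a + T]` for the
initial state `x₀`. -/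
def IsMinimizer (lam M T a : ℝ) (x₀ : X) (u : ℝ → Y) : Prop :=
  IsAdmissible Y M T a u ∧
    ∀ v : ℝ → Y, IsAdmissible Y M T a v →
      S.cost φ yref lam T a x₀ u ≤ S.cost φ yref lam T a x₀ v

/-- The optimal control problem on `[a, a + T]` with initial state `x₀` has a solution: there is a
minimizer, and its cost is not `∞`. -/
def OCPSolvable (lam M T a : ℝ) (x₀ : X) : Prop :=
  ∃ u : ℝ → Y, S.IsMinimizer φ yref lam M T a x₀ u ∧ S.cost φ yref lam T a x₀ u ≠ ⊤

/-! #### The algorithm -/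

/-- The `k`-th step of the algorithm (with current time `t₀ + k δ`): on
`[t₀ + k δ, t₀ + (k + 1) δ)` the applied input `u` is some solution of the optimal control problem
with the measured state `x(t₀ + k δ)` as initial state. -/
def IsFeedbackStep (lam M T δ t₀ : ℝ) (x : ℝ → X) (u : ℝ → Y) (k : ℕ) : Prop :=
  ∃ ustar : ℝ → Y,
    S.IsMinimizer φ yref lam M T (t₀ + k * δ) (x (t₀ + k * δ)) ustar ∧
    ∀ t ∈ Ico (t₀ + k * δ) (t₀ + (k + 1) * δ), u t = ustar t

/-- `x`, `u` are state and input after the first `N` steps of the algorithm. -/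
def IsRun (lam M T δ t₀ : ℝ) (x₀ : X) (N : ℕ) (x : ℝ → X) (u : ℝ → Y) : Prop :=
  IsSolutionOn (S.rhs u) t₀ (t₀ + N * δ) x₀ x ∧
    ∀ k < N, S.IsFeedbackStep φ yref lam M T δ t₀ x u k

/-- `x` is a global solution of the closed loop, with corresponding input `u`. -/
def IsClosedLoop (lam M T δ t₀ : ℝ) (x₀ : X) (x : ℝ → X) (u : ℝ → Y) : Prop :=
  IsGlobalSolution (S.rhs u) t₀ x₀ x ∧
    ∀ k : ℕ, S.IsFeedbackStep φ yref lam M T δ t₀ x u k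

end ControlSystem

end FunnelMPC

end

set_option linter.unusedSectionVars false

namespace FunnelMPC

/-! ### Functions in `W^{1,∞}` are bounded and Lipschitz continuous -/

/-! A single bound `M` must serve all sampling instants and all horizons, although later states need
not lie in `B`. The remedy is to track, instead of membership in `B`, a property that propagates:
`IsSafe`, which says that under every continuous output bounded by `Cy` and compatible with the
current state the internal dynamics stay below `c₁`. The BIBS condition gives it on `B`
(`exists_isSafe`). Concatenating the past output with an arbitrary future one passes it on along
funnel trajectories with the same `c₁` (`IsSafe.of_trajectory`); applying BIBS afresh at each step
could make the constants grow.

Feasibility: from a safe state in the funnel, prescribe an output that keeps `φ ‖y - y_ref‖`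
constant. It is uniformly Lipschitz, because `φ` and `y_ref` are Lipschitz and `φ` is bounded away
from zero. The internal state then stays bounded by `c₁`, and solving the Byrnes-Isidori form for
the input gives `u = Γ⁻¹ (y' - p(y, η))`, bounded by a constant `M` that depends only on a compact
set and the Lipschitz constant (`exists_control_bound`).

Finite cost means staying in the funnel: with bounded controls `φ ‖e‖` is Lipschitz along solutions,
so at a first contact with the boundary the stage cost would grow at least like a multiple of `1 /
(τ - t)`, which is not integrable (`lt_one_of_lintegral_ne_top`).

Optimal controls exist by the direct method (`exists_trajectoryCost_le`). Safety bounds all funnel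
trajectories in norm; Arzelà-Ascoli gives a uniform limit of the states, weak `L²` limits give a
control, the dynamics pass to the limit because they are affine in the control, and the cost is
lower semicontinuous by Fatou and by weak lower semicontinuity of the norm.

The pair "in the funnel and safe" is therefore invariant under the algorithm and implies
solvability; induction over the steps and gluing of the optimal pieces give all the claims. -/

theorem exists_smooth_step (s : ℝ) {δ : ℝ} (hδ : 0 < δ) :
    ∃ A : ℝ → ℝ, ContDiff ℝ ∞ A ∧ (∀ τ, 0 ≤ A τ ∧ A τ ≤ 1) ∧ (∀ τ, τ ≤ s → A τ = 0) ∧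
      (∀ τ, s + δ ≤ τ → A τ = 1) ∧ (∀ τ, 0 ≤ deriv A τ) ∧
      ∀ τ, τ ∉ Icc s (s + δ) → deriv A τ = 0 := by
  have h0 : ∀ τ, τ ≤ s → Real.smoothTransition ((τ - s) / δ) = 0 := fun τ h =>
    Real.smoothTransition.zero_of_nonpos (div_nonpos_of_nonpos_of_nonneg (by linarith) hδ.le)
  have h1 : ∀ τ, s + δ ≤ τ → Real.smoothTransition ((τ - s) / δ) = 1 := fun τ h =>
    Real.smoothTransition.one_of_one_le ((one_le_div hδ).2 (by linarith))
  refine ⟨fun τ => Real.smoothTransition ((τ - s) / δ), ?_, fun τ =>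
    ⟨Real.smoothTransition.nonneg _, Real.smoothTransition.le_one _⟩, h0, h1, fun τ => ?_, ?_⟩
  · exact Real.smoothTransition.contDiff.comp ((contDiff_id.sub contDiff_const).div_const δ)
  · refine Monotone.deriv_nonneg (fun a b hab => Real.smoothTransition.monotone ?_)
    exact div_le_div_of_nonneg_right (by linarith) hδ.le
  · intro τ hτ
    rw [mem_Icc, not_and_or, not_le, not_le] at hτ
    rcases hτ with h | h
    · have : (fun τ => Real.smoothTransition ((τ - s) / δ)) =ᶠ[𝓝 τ] fun _ => 0 := by
        filter_upwards [Iio_mem_nhds h] with x hx using h0 x (le_of_lt hx)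
      rw [this.deriv_eq, deriv_const]
    · have : (fun τ => Real.smoothTransition ((τ - s) / δ)) =ᶠ[𝓝 τ] fun _ => 1 := by
        filter_upwards [Ioi_mem_nhds h] with x hx using h1 x (le_of_lt hx)
      rw [this.deriv_eq, deriv_const]

variable {E : Type*} [NormedAddCommGroup E] [NormedSpace ℝ E] [FiniteDimensional ℝ E]

/-- Averaging against the derivative of a smooth step at `s` nearly evaluates at `s`. -/
theorem norm_integral_deriv_smul_sub_le {A : ℝ → ℝ} {v : ℝ → E} {s δ ε : ℝ} {c : E}
    (hδ : 0 < δ) (hs : 0 < s) (hA : ContDiff ℝ ∞ A) (hAs : A s = 0) (hAt : A (s + δ) = 1)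
    (hpos : ∀ τ, 0 ≤ deriv A τ) (hzero : ∀ τ, τ ∉ Icc s (s + δ) → deriv A τ = 0)
    (hv : ContinuousOn v (Ici 0)) (hc : ∀ τ ∈ Icc s (s + δ), ‖v τ - c‖ ≤ ε) :
    IntegrableOn (fun τ => deriv A τ • v τ) (Ioi 0) ∧
      ‖(∫ τ in Ioi (0 : ℝ), deriv A τ • v τ) - c‖ ≤ ε := by
  have hsub : Icc s (s + δ) ⊆ Ioi 0 := fun τ hτ => lt_of_lt_of_le hs hτ.1
  have hcA : Continuous (deriv A) := hA.continuous_deriv (by simp)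
  have hvI : ContinuousOn v (Icc s (s + δ)) := hv.mono fun τ hτ => mem_Ici.2 (mem_Ioi.1 (hsub hτ)).le
  have hint : IntegrableOn (fun τ => deriv A τ • v τ) (Icc s (s + δ)) :=
    (hcA.continuousOn.smul hvI).integrableOn_Icc
  have hAint : ∫ τ in Icc s (s + δ), deriv A τ = 1 := by
    rw [integral_Icc_eq_integral_Ioc, ← intervalIntegral.integral_of_le (by linarith),
      intervalIntegral.integral_deriv_eq_sub
        (fun x _ => (hA.differentiable (by simp)).differentiableAt)
        (hcA.intervalIntegrable _ _), hAs, hAt, sub_zero]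
  have hz : ∀ τ ∈ Ioi (0 : ℝ) \ Icc s (s + δ), deriv A τ • v τ = 0 := fun τ hτ => by
    rw [hzero τ hτ.2, zero_smul]
  refine ⟨(hint.of_forall_sdiff_eq_zero measurableSet_Ioi hz), ?_⟩
  rw [setIntegral_eq_of_subset_of_forall_sdiff_eq_zero measurableSet_Ioi hsub hz]
  have hcint : IntegrableOn (fun τ => deriv A τ • c) (Icc s (s + δ)) :=
    (hcA.continuousOn.smul continuousOn_const).integrableOn_Icc
  have hkey : (∫ τ in Icc s (s + δ), deriv A τ • v τ) - c =
      ∫ τ in Icc s (s + δ), deriv A τ • (v τ - c) := by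
    have h1 : ∫ τ in Icc s (s + δ), deriv A τ • c = c := by
      rw [integral_smul_const, hAint, one_smul]
    simp_rw [smul_sub]
    rw [integral_sub hint hcint, h1]
  rw [hkey]
  calc ‖∫ τ in Icc s (s + δ), deriv A τ • (v τ - c)‖
      ≤ ∫ τ in Icc s (s + δ), deriv A τ * ε := by
        refine norm_integral_le_of_norm_le ?_ ?_
        · exact (hcA.continuousOn.mul continuousOn_const).integrableOn_Icc
        · refine (ae_restrict_iff' measurableSet_Icc).2 (Filter.Eventually.of_forall ?_)
          intro τ hτ
          rw [norm_smul, Real.norm_of_nonneg (hpos τ)]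
          exact mul_le_mul_of_nonneg_left (hc τ hτ) (hpos τ)
    _ = ε := by rw [integral_mul_const, hAint, one_mul]

/-- The test function is a smoothed indicator of `[s, t]`, the difference of a step up at `s` and a
step up at `t`. Its derivative nearly evaluates `v s - v t`, while the integral of `w` against it is
at most `C` times the length of the support. -/
theorem IsWeakDeriv.norm_sub_le {v w : ℝ → E} {C : ℝ} (hv : ContinuousOn v (Ici 0))
    (hw : ∀ᵐ t ∂(volume.restrict (Ioi (0 : ℝ))), ‖w t‖ ≤ C) (hC : 0 ≤ C)
    (h : IsWeakDeriv v w) {s t : ℝ} (hs : 0 < s) (hst : s < t) :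
    ‖v t - v s‖ ≤ C * (t - s) := by
  refine le_of_forall_pos_le_add fun ε hε => ?_
  -- Two evaluation errors `η`, plus `C * δ ≤ C * η` for the widened support, add up to at most `ε`.
  set η := ε / (2 + C) with hη
  have hη0 : 0 < η := by positivity
  have hcont : ∀ r, 0 < r → ∃ d > 0, ∀ τ ∈ Icc r (r + d), ‖v τ - v r‖ ≤ η := by
    intro r hr
    have hca : ContinuousAt v r := hv.continuousAt (Ici_mem_nhds hr)
    obtain ⟨d, hd, hd'⟩ := Metric.continuousAt_iff.1 hca η hη0
    refine ⟨d / 2, by positivity, fun τ hτ => ?_⟩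
    rw [← dist_eq_norm]
    refine (hd' ?_).le
    rw [Real.dist_eq, abs_of_nonneg (by linarith [hτ.1])]
    linarith [hτ.2]
  obtain ⟨d₁, hd₁, H₁⟩ := hcont s hs
  obtain ⟨d₂, hd₂, H₂⟩ := hcont t (hs.trans hst)
  obtain ⟨δ, hδ, hδ₁, hδ₂, hδη⟩ : ∃ δ > 0, δ ≤ d₁ ∧ δ ≤ d₂ ∧ δ ≤ η :=
    ⟨min (min d₁ d₂) η, by positivity, (min_le_left _ _).trans (min_le_left _ _),
      (min_le_left _ _).trans (min_le_right _ _), min_le_right _ _⟩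
  obtain ⟨A, hA, hA01, hA0, hA1, hApos, hAz⟩ := exists_smooth_step s hδ
  obtain ⟨B, hB, hB01, hB0, hB1, hBpos, hBz⟩ := exists_smooth_step t hδ
  obtain ⟨iA, nA⟩ := norm_integral_deriv_smul_sub_le (v := v) (c := v s) (ε := η) hδ hs hA
    (hA0 s le_rfl) (hA1 _ le_rfl) hApos hAz hv
    (fun τ hτ => H₁ τ ⟨hτ.1, hτ.2.trans (by linarith)⟩)
  obtain ⟨iB, nB⟩ := norm_integral_deriv_smul_sub_le (v := v) (c := v t) (ε := η) hδ
    (hs.trans hst) hB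
    (hB0 t le_rfl) (hB1 _ le_rfl) hBpos hBz hv
    (fun τ hτ => H₂ τ ⟨hτ.1, hτ.2.trans (by linarith)⟩)
  have hsupp : ∀ τ, τ ∉ Icc s (t + δ) → A τ - B τ = 0 := by
    intro τ hτ
    rw [mem_Icc, not_and_or, not_le, not_le] at hτ
    rcases hτ with h | h
    · rw [hA0 τ h.le, hB0 τ (h.trans hst).le, sub_zero]
    · rw [hA1 τ (by linarith), hB1 τ h.le, sub_self]
  have htsupp : tsupport (fun τ => A τ - B τ) ⊆ Icc s (t + δ) :=
    closure_minimal (fun τ hτ => by_contra fun hn => hτ (hsupp τ hn)) isClosed_Icc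
  have hsub : Icc s (t + δ) ⊆ Ioi 0 := fun τ hτ => lt_of_lt_of_le hs hτ.1
  have key := h (fun τ => A τ - B τ) (hA.sub hB)
    (isCompact_Icc.of_isClosed_subset (isClosed_tsupport _) htsupp) (htsupp.trans hsub)
  have hder : ∀ τ, deriv (fun τ => A τ - B τ) τ • v τ = deriv A τ • v τ - deriv B τ • v τ := by
    intro τ
    rw [deriv_fun_sub (hA.differentiable (by simp)).differentiableAt
      (hB.differentiable (by simp)).differentiableAt, sub_smul]
  simp_rw [hder] at key
  rw [integral_sub iA iB] at key
  have hr : ‖∫ τ in Ioi (0 : ℝ), (A τ - B τ) • w τ‖ ≤ C * (t + δ - s) := by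
    rw [setIntegral_eq_of_subset_of_forall_sdiff_eq_zero measurableSet_Ioi hsub
      (fun τ hτ => by rw [hsupp τ hτ.2, zero_smul])]
    refine (norm_setIntegral_le_of_norm_le_const_ae (C := C) (by simp) ?_).trans ?_
    · filter_upwards [ae_restrict_of_ae_restrict_of_subset hsub hw] with τ hτ
      rw [norm_smul]
      have : ‖A τ - B τ‖ ≤ 1 := by
        rw [Real.norm_eq_abs, abs_le]
        constructor <;> linarith [(hA01 τ).1, (hA01 τ).2, (hB01 τ).1, (hB01 τ).2]
      calc _ ≤ 1 * ‖w τ‖ := mul_le_mul_of_nonneg_right this (norm_nonneg _)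
        _ ≤ C := by rwa [one_mul]
    · rw [Real.volume_real_Icc_of_le (by linarith)]
  set a := ∫ τ in Ioi (0 : ℝ), deriv A τ • v τ
  set b := ∫ τ in Ioi (0 : ℝ), deriv B τ • v τ
  have e : v t - v s = (a - v s) - (b - v t) - (a - b) := by abel
  calc ‖v t - v s‖ ≤ ‖a - v s‖ + ‖b - v t‖ + ‖a - b‖ := by
        rw [e]; exact (_root_.norm_sub_le _ _).trans (add_le_add (_root_.norm_sub_le _ _) le_rfl)
    _ ≤ η + η + C * (t + δ - s) := by
        rw [key, norm_neg]; gcongr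
    _ ≤ C * (t - s) + ε := by
        have : η * (2 + C) = ε := div_mul_cancel₀ _ (by positivity)
        nlinarith [mul_le_mul_of_nonneg_left hδη hC]

theorem MemW1Infty.exists_lipschitz {v : ℝ → E} (hv : MemW1Infty v) :
    ∃ C : ℝ, 0 ≤ C ∧ ∀ s t : ℝ, 0 ≤ s → 0 ≤ t → ‖v t - v s‖ ≤ C * |t - s| := by
  obtain ⟨hc, -, w, hw, hvw⟩ := hv
  set C := (eLpNorm w ⊤ (volume.restrict (Ioi (0 : ℝ)))).toReal
  have hwC : ∀ᵐ t ∂(volume.restrict (Ioi (0 : ℝ))), ‖w t‖ ≤ C := by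
    have h1 := ae_le_eLpNormEssSup (f := w) (μ := volume.restrict (Ioi (0 : ℝ)))
    filter_upwards [h1] with t ht
    rw [← eLpNorm_exponent_top] at ht
    rw [← toReal_enorm]
    exact ENNReal.toReal_mono hw.2.ne ht
  have hC : 0 ≤ C := ENNReal.toReal_nonneg
  refine ⟨C, hC, ?_⟩
  have hpos : ∀ s t : ℝ, 0 < s → 0 < t → ‖v t - v s‖ ≤ C * |t - s| := by
    intro s t hs ht
    rcases lt_trichotomy s t with h | h | h
    · rw [abs_of_pos (sub_pos.2 h)]
      exact hvw.norm_sub_le hc hwC hC hs h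
    · simp [h]
    · rw [norm_sub_rev, abs_sub_comm, abs_of_pos (sub_pos.2 h)]
      exact hvw.norm_sub_le hc hwC hC ht h
  -- Weak derivatives see only positive times; continuity carries the Lipschitz bound to `0`.
  have hL : LipschitzOnWith C.toNNReal v (Ici 0) := by
    rw [← closure_Ioi (0 : ℝ)] at hc ⊢
    rw [lipschitzOnWith_closure_iff hc]
    refine LipschitzOnWith.of_dist_le_mul fun s hs t ht => ?_
    rw [dist_eq_norm, Real.dist_eq, Real.coe_toNNReal C hC]
    exact hpos t s ht hs
  intro s t hs ht
  have := hL.dist_le_mul t ht s hs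
  rwa [dist_eq_norm, Real.dist_eq, Real.coe_toNNReal C hC] at this

/-- A bound that holds almost everywhere holds on a dense set, hence everywhere by continuity. -/
theorem MemW1Infty.exists_bound {E : Type*} [NormedAddCommGroup E] [NormedSpace ℝ E]
    {v : ℝ → E} (hv : MemW1Infty v) :
    ∃ C : ℝ, 0 ≤ C ∧ ∀ t : ℝ, 0 ≤ t → ‖v t‖ ≤ C := by
  obtain ⟨hc, hb, -⟩ := hv
  set C := (eLpNorm v ⊤ (volume.restrict (Ioi (0 : ℝ)))).toReal
  refine ⟨C, ENNReal.toReal_nonneg, ?_⟩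
  have hae : ∀ᵐ t ∂(volume.restrict (Ioi (0 : ℝ))), ‖v t‖ ≤ C := by
    filter_upwards [ae_le_eLpNormEssSup (f := v) (μ := volume.restrict (Ioi (0 : ℝ)))] with t ht
    rw [← eLpNorm_exponent_top] at ht
    rw [← toReal_enorm]
    exact ENNReal.toReal_mono hb.2.ne ht
  have hdense : Ici (0 : ℝ) ⊆ closure {t | t ∈ Ioi (0 : ℝ) ∧ ‖v t‖ ≤ C} := by
    intro t ht
    rw [Metric.mem_closure_iff]
    intro ε hε
    by_contra! hn
    have hnull : volume (Ioo t (t + ε)) = 0 := by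
      rw [ae_restrict_iff' measurableSet_Ioi] at hae
      refine measure_mono_null (fun τ hτ => ?_) hae
      intro hcon
      have hτ0 : τ ∈ Ioi (0 : ℝ) := lt_of_le_of_lt ht hτ.1
      have := hn τ ⟨hτ0, hcon hτ0⟩
      rw [Real.dist_eq, abs_sub_comm, abs_of_pos (by linarith [hτ.1])] at this
      linarith [hτ.2]
    simp [hε.not_ge] at hnull
  intro t ht
  have hcl := hdense ht
  refine ContinuousWithinAt.closure_le (f := fun t => ‖v t‖) (g := fun _ => C) hcl ?_
    continuousWithinAt_const fun y hy => hy.2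
  exact ((hc t ht).mono fun y hy => mem_Ici.2 (mem_Ioi.1 hy.1).le).norm

end FunnelMPC

namespace FunnelMPC

/-! ### Carathéodory solutions with essentially bounded velocity -/

theorem _root_.AbsolutelyContinuousOnInterval.congr {E : Type*} [PseudoMetricSpace E]
    {x x' : ℝ → E} {a b : ℝ} (h : AbsolutelyContinuousOnInterval x a b)
    (hxx : ∀ t ∈ uIcc a b, x t = x' t) : AbsolutelyContinuousOnInterval x' a b := by
  rw [absolutelyContinuousOnInterval_iff] at h ⊢
  intro ε hε
  obtain ⟨δ, hδ, H⟩ := h ε hε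
  refine ⟨δ, hδ, fun I hI hI' => ?_⟩
  rw [← Finset.sum_congr rfl fun i hi => ?_]
  · exact H I hI hI'
  · rw [hxx _ (hI.1 i hi).1, hxx _ (hI.1 i hi).2]

theorem ae_restrict_Icc_of_Ioo {a b : ℝ} {P : ℝ → Prop}
    (h : ∀ᵐ t ∂(volume.restrict (Ioo a b)), P t) : ∀ᵐ t ∂(volume.restrict (Icc a b)), P t := by
  rwa [← restrict_Ioo_eq_restrict_Icc]

theorem ae_restrict_Ioo_of_Icc {a b : ℝ} {P : ℝ → Prop}
    (h : ∀ᵐ t ∂(volume.restrict (Icc a b)), P t) : ∀ᵐ t ∂(volume.restrict (Ioo a b)), P t := by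
  rwa [restrict_Ioo_eq_restrict_Icc]

variable {E : Type*} [NormedAddCommGroup E] [NormedSpace ℝ E] [FiniteDimensional ℝ E]
  {F G : ℝ → E → E} {a b c C : ℝ} {x₀ : E} {x x' : ℝ → E}

theorem IsSolutionOn.mono (h : IsSolutionOn F a b x₀ x) (hac : a ≤ c) (hcb : c ≤ b) :
    IsSolutionOn F a c x₀ x :=
  ⟨h.1, h.2.1.mono (by
    rw [uIcc_of_le hac, uIcc_of_le (hac.trans hcb)]; exact Icc_subset_Icc_right hcb),
    ae_restrict_of_ae_restrict_of_subset (Ioo_subset_Ioo_right hcb) h.2.2⟩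

theorem IsSolutionOn.tail (h : IsSolutionOn F a b x₀ x) (hac : a ≤ c) (hcb : c ≤ b) :
    IsSolutionOn F c b (x c) x :=
  ⟨rfl, h.2.1.mono (by
    rw [uIcc_of_le hcb, uIcc_of_le (hac.trans hcb)]; exact Icc_subset_Icc_left hac),
    ae_restrict_of_ae_restrict_of_subset (Ioo_subset_Ioo_left hac) h.2.2⟩

theorem IsSolutionOn.continuousOn (h : IsSolutionOn F a b x₀ x) (hab : a ≤ b) :
    ContinuousOn x (Icc a b) := by
  have := h.2.1.continuousOn
  rwa [uIcc_of_le hab] at this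

theorem IsSolutionOn.exists_bound (h : IsSolutionOn F a b x₀ x) (hab : a ≤ b) :
    ∃ R : ℝ, ∀ t ∈ Icc a b, ‖x t‖ ≤ R :=
  isCompact_Icc.exists_bound_of_continuousOn (h.continuousOn hab)

theorem IsSolutionOn.congr (h : IsSolutionOn F a b x₀ x) (hab : a ≤ b)
    (hx : ∀ t ∈ Icc a b, x t = x' t)
    (hF : ∀ᵐ t ∂(volume.restrict (Ioo a b)), F t (x t) = G t (x t)) :
    IsSolutionOn G a b x₀ x' := by
  refine ⟨(hx a ⟨le_rfl, hab⟩) ▸ h.1, h.2.1.congr (by rwa [uIcc_of_le hab]), ?_⟩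
  filter_upwards [h.2.2, hF, ae_restrict_mem measurableSet_Ioo] with t ht hFt htI
  rw [← hx t (Ioo_subset_Icc_self htI), ← hFt]
  refine ht.congr_of_eventuallyEq ?_
  filter_upwards [Ioo_mem_nhds htI.1 htI.2] with s hs using (hx s (Ioo_subset_Icc_self hs)).symm

/-! ### Integral form of Carathéodory solutions. -/

theorem norm_intervalIntegral_le_of_ae {v : ℝ → E} {s t : ℝ} (hst : s ≤ t)
    (hs : a ≤ s) (ht : t ≤ b)
    (hC : ∀ᵐ τ ∂(volume.restrict (Icc a b)), ‖v τ‖ ≤ C) :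
    ‖∫ τ in s..t, v τ‖ ≤ C * (t - s) := by
  rw [intervalIntegral.integral_of_le hst]
  refine (norm_setIntegral_le_of_norm_le_const_ae (C := C) (by simp) ?_).trans ?_
  · exact ae_restrict_of_ae_restrict_of_subset
      (Ioc_subset_Icc_self.trans (Icc_subset_Icc hs ht)) hC
  · rw [Real.volume_real_Ioc_of_le hst]

theorem norm_intervalIntegral_sub_le {v : ℝ → E} {s t : ℝ}
    (hv : IntegrableOn v (Icc a b)) (hs : s ∈ Icc a b) (ht : t ∈ Icc a b)
    (hC : ∀ᵐ τ ∂(volume.restrict (Icc a b)), ‖v τ‖ ≤ C) :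
    ‖(∫ τ in a..t, v τ) - ∫ τ in a..s, v τ‖ ≤ C * |t - s| := by
  have hi : ∀ r ∈ Icc a b, IntervalIntegrable v volume a r := fun r hr =>
    (intervalIntegrable_iff_integrableOn_Icc_of_le hr.1).2
      (hv.mono_set (Icc_subset_Icc_right hr.2))
  rw [intervalIntegral.integral_interval_sub_left (hi t ht) (hi s hs)]
  rcases le_total s t with h | h
  · rw [abs_of_nonneg (sub_nonneg.2 h)]
    exact norm_intervalIntegral_le_of_ae h hs.1 ht.2 hC
  · rw [intervalIntegral.integral_symm, norm_neg, abs_sub_comm, abs_of_nonneg (sub_nonneg.2 h)]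
    exact norm_intervalIntegral_le_of_ae h ht.1 hs.2 hC

theorem absolutelyContinuousOnInterval_of_norm_sub_le {v : ℝ → E} (hab : a ≤ b)
    (h : ∀ s ∈ Icc a b, ∀ t ∈ Icc a b, ‖v t - v s‖ ≤ C * |t - s|) :
    AbsolutelyContinuousOnInterval v a b := by
  refine LipschitzOnWith.absolutelyContinuousOnInterval (K := C.toNNReal) ?_
  rw [uIcc_of_le hab]
  refine LipschitzOnWith.of_dist_le_mul fun s hs t ht => ?_
  rw [dist_eq_norm, Real.dist_eq]
  exact (h t ht s hs).trans (mul_le_mul_of_nonneg_right (Real.le_coe_toNNReal C) (abs_nonneg _))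

/-- No measurability of `F` is assumed: along a solution the velocity agrees almost everywhere with
`deriv x`, which is measurable. -/
theorem IsSolutionOn.integrableOn (h : IsSolutionOn F a b x₀ x)
    (hC : ∀ᵐ t ∂(volume.restrict (Icc a b)), ‖F t (x t)‖ ≤ C) :
    IntegrableOn (fun t => F t (x t)) (Icc a b) := by
  have hm : AEStronglyMeasurable (fun t => F t (x t)) (volume.restrict (Icc a b)) := by
    refine (stronglyMeasurable_deriv x).aestronglyMeasurable.congr ?_
    filter_upwards [ae_restrict_Icc_of_Ioo h.2.2] with t ht using ht.deriv
  exact ⟨hm, HasFiniteIntegral.of_bounded hC⟩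

/-- The difference of the two sides is absolutely continuous with derivative zero almost everywhere,
hence constant. -/
theorem IsSolutionOn.integral_eq (h : IsSolutionOn F a b x₀ x) (hab : a ≤ b)
    (hC : ∀ᵐ t ∂(volume.restrict (Icc a b)), ‖F t (x t)‖ ≤ C) :
    ∀ t ∈ Icc a b, x t = x₀ + ∫ s in a..t, F s (x s) := by
  have hint := h.integrableOn hC
  have hac : AbsolutelyContinuousOnInterval (fun t => ∫ s in a..t, F s (x s)) a b :=
    absolutelyContinuousOnInterval_of_norm_sub_le hab fun s hs t ht =>
      norm_intervalIntegral_sub_le hint hs ht hC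
  have hz : ∀ᵐ t, t ∈ uIcc a b →
      HasDerivAt (x - fun t => ∫ s in a..t, F s (x s)) 0 t := by
    have h1 := (ae_restrict_iff' measurableSet_Icc).1 (ae_restrict_Icc_of_Ioo h.2.2)
    have h2 := ((intervalIntegrable_iff_integrableOn_Icc_of_le hab).2 hint).ae_hasDerivAt_integral
    filter_upwards [h1, h2] with t h1 h2 ht
    have h2 := h2 ht a left_mem_uIcc
    rw [uIcc_of_le hab] at ht
    simpa using (h1 ht).sub h2
  obtain ⟨K, hK⟩ := (h.2.1.sub hac).const_of_ae_hasDerivAt_zero hz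
  rw [uIcc_of_le hab] at hK
  have hKa : x₀ = K := by simpa [h.1] using hK a ⟨le_rfl, hab⟩
  intro t ht
  have := hK t ht
  rw [hKa, ← this]
  simp

theorem isSolutionOn_of_integral_eq (hab : a ≤ b)
    (hint : IntegrableOn (fun t => F t (x t)) (Icc a b))
    (hC : ∀ᵐ t ∂(volume.restrict (Icc a b)), ‖F t (x t)‖ ≤ C)
    (hx : ∀ t ∈ Icc a b, x t = x₀ + ∫ s in a..t, F s (x s)) :
    IsSolutionOn F a b x₀ x := by
  refine ⟨by simpa using hx a ⟨le_rfl, hab⟩, ?_, ?_⟩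
  · refine absolutelyContinuousOnInterval_of_norm_sub_le (C := C) hab fun s hs t ht => ?_
    rw [hx s hs, hx t ht, add_sub_add_left_eq_sub]
    exact norm_intervalIntegral_sub_le hint hs ht hC
  · have h2 := ((intervalIntegrable_iff_integrableOn_Icc_of_le hab).2 hint).ae_hasDerivAt_integral
    filter_upwards [ae_restrict_of_ae h2, ae_restrict_mem measurableSet_Ioo] with t h2 ht
    have h2 := (h2 (by rw [uIcc_of_le hab]; exact Ioo_subset_Icc_self ht) a
      left_mem_uIcc).const_add x₀
    refine h2.congr_of_eventuallyEq ?_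
    filter_upwards [Ioo_mem_nhds ht.1 ht.2] with s hs using hx s (Ioo_subset_Icc_self hs)

theorem IsSolutionOn.norm_sub_le (h : IsSolutionOn F a b x₀ x) (hab : a ≤ b)
    (hC : ∀ᵐ t ∂(volume.restrict (Icc a b)), ‖F t (x t)‖ ≤ C) :
    ∀ s ∈ Icc a b, ∀ t ∈ Icc a b, ‖x t - x s‖ ≤ C * |t - s| := by
  intro s hs t ht
  rw [h.integral_eq hab hC s hs, h.integral_eq hab hC t ht, add_sub_add_left_eq_sub]
  exact norm_intervalIntegral_sub_le (h.integrableOn hC) hs ht hC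

/-- Gluing goes through the integral form, where additivity over adjacent intervals replaces any
argument about absolute continuity across `b`. -/
theorem IsSolutionOn.trans (h₁ : IsSolutionOn F a b x₀ x) (h₂ : IsSolutionOn F b c (x b) x)
    (hab : a ≤ b) (hbc : b ≤ c)
    (hC : ∀ᵐ t ∂(volume.restrict (Icc a c)), ‖F t (x t)‖ ≤ C) :
    IsSolutionOn F a c x₀ x := by
  have hC₁ := ae_restrict_of_ae_restrict_of_subset (Icc_subset_Icc_right hbc) hC
  have hC₂ := ae_restrict_of_ae_restrict_of_subset (Icc_subset_Icc_left hab) hC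
  have i₁ := h₁.integrableOn hC₁
  have i₂ := h₂.integrableOn hC₂
  have hint : IntegrableOn (fun t => F t (x t)) (Icc a c) := by
    rw [← Icc_union_Icc_eq_Icc hab hbc]
    exact i₁.union i₂
  refine isSolutionOn_of_integral_eq (hab.trans hbc) hint hC fun t ht => ?_
  rcases le_total t b with htb | htb
  · exact h₁.integral_eq hab hC₁ t ⟨ht.1, htb⟩
  · rw [h₂.integral_eq hbc hC₂ t ⟨htb, ht.2⟩, h₁.integral_eq hab hC₁ b ⟨hab, le_rfl⟩, add_assoc,
      intervalIntegral.integral_add_adjacent_intervals]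
    · exact (intervalIntegrable_iff_integrableOn_Icc_of_le hab).2 i₁
    · exact (intervalIntegrable_iff_integrableOn_Icc_of_le htb).2
        (i₂.mono_set (Icc_subset_Icc_right ht.2))

/-- On balls, `F t` is bounded and Lipschitz continuous uniformly in almost all `t ∈ [a, b]`. -/
def IsLocallyLipschitzField (F : ℝ → E → E) (a b : ℝ) : Prop :=
  ∀ R : ℝ, ∃ C : ℝ, ∀ᵐ t ∂(volume.restrict (Icc a b)),
    (∀ z, ‖z‖ ≤ R → ‖F t z‖ ≤ C) ∧
    ∀ z z', ‖z‖ ≤ R → ‖z'‖ ≤ R → ‖F t z - F t z'‖ ≤ C * ‖z - z'‖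

theorem IsLocallyLipschitzField.mono (hF : IsLocallyLipschitzField F a b) {a' b' : ℝ}
    (ha : a ≤ a') (hb : b' ≤ b) : IsLocallyLipschitzField F a' b' := fun R =>
  (hF R).imp fun _ h => ae_restrict_of_ae_restrict_of_subset (Icc_subset_Icc ha hb) h

theorem IsSolutionOn.ae_norm_le (h : IsSolutionOn F a b x₀ x) (hab : a ≤ b)
    (hF : IsLocallyLipschitzField F a b) :
    ∃ C : ℝ, ∀ᵐ t ∂(volume.restrict (Icc a b)), ‖F t (x t)‖ ≤ C := by
  obtain ⟨R, hR⟩ := h.exists_bound hab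
  obtain ⟨C, hC⟩ := hF R
  refine ⟨C, ?_⟩
  filter_upwards [hC, ae_restrict_mem measurableSet_Icc] with t ht htI using ht.1 _ (hR t htI)

theorem eq_zero_of_le_integral {d : ℝ → ℝ} (hd : ContinuousOn d (Icc a b))
    (hd0 : ∀ t ∈ Icc a b, 0 ≤ d t)
    (h : ∀ t ∈ Icc a b, d t ≤ C * ∫ s in a..t, d s) : ∀ t ∈ Icc a b, d t = 0 := by
  intro t₁ ht₁
  have hab : a ≤ b := ht₁.1.trans ht₁.2
  -- A continuous extension to `ℝ` makes the primitive `W` differentiable everywhere, endpoints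
  -- included. Then `W' ≤ C W` and `W a = 0`, so Grönwall forces `W = 0`.
  set D : ℝ → ℝ := IccExtend hab (domRestrict (Icc a b) d)
  have hD : Continuous D := (continuousOn_iff_continuous_domRestrict.1 hd).Icc_extend'
  have hDd : ∀ t ∈ Icc a b, D t = d t := fun t ht => by
    simp [D, IccExtend_of_mem hab _ ht, domRestrict_apply]
  have hint : ∀ t ∈ Icc a b, ∫ s in a..t, d s = ∫ s in a..t, D s := fun t ht => by
    refine intervalIntegral.integral_congr fun s hs => (hDd s ?_).symm
    rw [uIcc_of_le ht.1] at hs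
    exact ⟨hs.1, hs.2.trans ht.2⟩
  set W : ℝ → ℝ := fun t => ∫ s in a..t, D s
  have hW : ∀ t, HasDerivAt W (D t) t := fun t =>
    intervalIntegral.integral_hasDerivAt_right (hD.intervalIntegrable _ _)
      (hD.stronglyMeasurableAtFilter _ _) hD.continuousAt
  have hle : ∀ t ∈ Icc a b, D t ≤ C * W t := fun t ht => by
    rw [hDd t ht]; exact (h t ht).trans_eq (by rw [hint t ht])
  have hW0 : ∀ t ∈ Icc a b, 0 ≤ W t := fun t ht =>
    intervalIntegral.integral_nonneg ht.1 fun s hs => by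
      have hs' : s ∈ Icc a b := ⟨hs.1, hs.2.trans ht.2⟩
      rw [hDd s hs']; exact hd0 s hs'
  have hg := norm_le_gronwallBound_of_norm_deriv_right_le (f := W) (f' := D) (δ := 0) (K := C)
    (ε := 0) (a := a) (b := b) (fun t _ => (hW t).continuousAt.continuousWithinAt)
    (fun t _ => (hW t).hasDerivWithinAt) (by simp [W]) (fun t ht => by
      have ht' := Ico_subset_Icc_self ht
      rw [Real.norm_of_nonneg (by rw [hDd t ht']; exact hd0 t ht'),
        Real.norm_of_nonneg (hW0 t ht'), add_zero]
      exact hle t ht')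
  have hWz : W t₁ = 0 := by
    have := hg t₁ ht₁
    rw [gronwallBound_ε0_δ0] at this
    exact norm_le_zero_iff.1 this
  refine le_antisymm ?_ (hd0 t₁ ht₁)
  rw [← hDd t₁ ht₁]
  simpa [hWz] using hle t₁ ht₁

/-- Both solutions remain in a common ball, on which the field is Lipschitz; the distance between
them then satisfies the integral form of Grönwall's inequality. -/
theorem IsSolutionOn.unique (h : IsSolutionOn F a b x₀ x) (h' : IsSolutionOn F a b x₀ x')
    (hab : a ≤ b) (hF : IsLocallyLipschitzField F a b) : ∀ t ∈ Icc a b, x t = x' t := by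
  obtain ⟨R, hR⟩ := h.exists_bound hab
  obtain ⟨R', hR'⟩ := h'.exists_bound hab
  obtain ⟨C₁, hC₁⟩ := h.ae_norm_le hab hF
  obtain ⟨C₂, hC₂⟩ := h'.ae_norm_le hab hF
  obtain ⟨C, hC⟩ := hF (max R R')
  have hcont : ContinuousOn (fun t => ‖x t - x' t‖) (Icc a b) :=
    ((h.continuousOn hab).sub (h'.continuousOn hab)).norm
  have key := eq_zero_of_le_integral (C := C) hcont (fun t _ => norm_nonneg _) (fun t ht => by
    have hsub : Icc a t ⊆ Icc a b := Icc_subset_Icc_right ht.2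
    have i₁ := (intervalIntegrable_iff_integrableOn_Icc_of_le ht.1).2
      ((h.integrableOn hC₁).mono_set hsub)
    have i₂ := (intervalIntegrable_iff_integrableOn_Icc_of_le ht.1).2
      ((h'.integrableOn hC₂).mono_set hsub)
    rw [h.integral_eq hab hC₁ t ht, h'.integral_eq hab hC₂ t ht, add_sub_add_left_eq_sub,
      ← intervalIntegral.integral_sub i₁ i₂, ← intervalIntegral.integral_const_mul]
    refine intervalIntegral.norm_integral_le_of_norm_le ht.1 ?_ ?_
    · have hC' := (ae_restrict_iff' measurableSet_Icc).1 hC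
      filter_upwards [hC'] with s hs hsI
      have hsI' := hsub (Ioc_subset_Icc_self hsI)
      exact (hs hsI').2 _ _ ((hR s hsI').trans (le_max_left _ _))
        ((hR' s hsI').trans (le_max_right _ _))
    · refine ContinuousOn.intervalIntegrable_of_Icc ht.1 ?_
      exact continuousOn_const.mul (hcont.mono hsub))
  exact fun t ht => sub_eq_zero.1 (norm_eq_zero.1 (key t ht))

end FunnelMPC

namespace FunnelMPC

/-! ### Weak limits of bounded sequences of controls -/

open Filter in
/-- A bounded sequence in a Hilbert space has a weak cluster point. -/
theorem exists_mem_of_isClosed_of_convex {H : Type*} [NormedAddCommGroup H]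
    [InnerProductSpace ℝ H] [CompleteSpace H] {u : ℕ → H} {R : ℝ} (hu : ∀ n, ‖u n‖ ≤ R) :
    ∃ v : H, ∀ C : Set H, IsClosed C → Convex ℝ C → (∀ᶠ n in atTop, u n ∈ C) → v ∈ C := by
  set K : ℕ → Set H := fun n => closure (convexHull ℝ (u '' Ici n)) with hK
  have hKconv : ∀ n, Convex ℝ (K n) := fun n => (convex_convexHull ℝ _).closure
  have hKmem : ∀ n, u n ∈ K n := fun n =>
    subset_closure (subset_convexHull ℝ _ ⟨n, mem_Ici.2 le_rfl, rfl⟩)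
  have hKanti : ∀ n m, n ≤ m → K m ⊆ K n := fun n m hnm =>
    closure_mono (convexHull_mono (image_mono (Ici_subset_Ici.2 hnm)))
  -- `p n` is the element of least norm in the closed convex hull of the `n`-th tail. The hulls
  -- decrease, so the norms of the `p n` increase; being bounded they converge, and `hdist` turns
  -- this into strong convergence. The limit lies in every closed convex set that contains a tail.
  have hmin : ∀ n, ∃ p ∈ K n, ∀ w ∈ K n, inner ℝ (0 - p) (w - p) ≤ 0 := fun n => by
    obtain ⟨p, hp, hp'⟩ := exists_norm_eq_iInf_of_complete_convex ⟨u n, hKmem n⟩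
      isClosed_closure.isComplete (hKconv n) 0
    exact ⟨p, hp, (norm_eq_iInf_iff_real_inner_le_zero (hKconv n) hp).1 hp'⟩
  choose p hp hpin using hmin
  have hin : ∀ n, ∀ w ∈ K n, ‖p n‖ ^ 2 ≤ inner ℝ (p n) w := fun n w hw => by
    have := hpin n w hw
    rw [zero_sub, inner_neg_left, inner_sub_right, real_inner_self_eq_norm_sq] at this
    linarith
  have hdist : ∀ n m, n ≤ m → ‖p m - p n‖ ^ 2 ≤ ‖p m‖ ^ 2 - ‖p n‖ ^ 2 := fun n m hnm => by
    have := hin n (p m) (hKanti n m hnm (hp m))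
    rw [norm_sub_sq_real, real_inner_comm]
    linarith
  have hmono : Monotone fun n => ‖p n‖ ^ 2 := fun n m hnm => by
    have := hdist n m hnm
    have := sq_nonneg ‖p m - p n‖
    change ‖p n‖ ^ 2 ≤ ‖p m‖ ^ 2
    linarith
  have hbdd : ∀ n, ‖p n‖ ^ 2 ≤ R ^ 2 := fun n => by
    have h1 := hin n (u n) (hKmem n)
    have h2 := real_inner_le_norm (p n) (u n)
    have h3 : ‖p n‖ ≤ R := by
      by_contra! hlt
      have h4 : 0 < ‖p n‖ := ((norm_nonneg _).trans (hu n)).trans_lt hlt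
      nlinarith [mul_lt_mul_of_pos_left ((hu n).trans_lt hlt) h4]
    exact pow_le_pow_left₀ (norm_nonneg _) h3 2
  have hconv := tendsto_atTop_ciSup hmono ⟨R ^ 2, by rintro _ ⟨n, rfl⟩; exact hbdd n⟩
  have hcauchy : CauchySeq p := by
    rw [Metric.cauchySeq_iff']
    intro ε hε
    obtain ⟨N, hN⟩ := Metric.cauchySeq_iff'.1 hconv.cauchySeq (ε ^ 2) (by positivity)
    refine ⟨N, fun n hn => ?_⟩
    have h1 := hN n hn
    rw [Real.dist_eq] at h1
    rw [dist_eq_norm]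
    exact lt_of_pow_lt_pow_left₀ 2 hε.le
      ((hdist N n hn).trans_lt ((le_abs_self _).trans_lt h1))
  obtain ⟨v, hv⟩ := cauchySeq_tendsto_of_complete hcauchy
  refine ⟨v, fun C hC hCc hev => ?_⟩
  obtain ⟨N, hN⟩ := eventually_atTop.1 hev
  refine hC.mem_of_tendsto hv (eventually_atTop.2 ⟨N, fun n hn => ?_⟩)
  refine closure_minimal (convexHull_min ?_ hCc) hC (hp n)
  rintro _ ⟨m, hm, rfl⟩
  exact hN m (le_trans hn hm)

variable {X Y : Type*} [NormedAddCommGroup X] [NormedSpace ℝ X] [FiniteDimensional ℝ X]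
  [NormedAddCommGroup Y] [NormedSpace ℝ Y] [FiniteDimensional ℝ Y] {a b M : ℝ}

open Filter in
theorem exists_mem_Lp_of_isClosed_of_convex {μ : Measure ℝ} {u : ℕ → Lp Y 2 μ} {R : ℝ}
    (hu : ∀ n, ‖u n‖ ≤ R) :
    ∃ v : Lp Y 2 μ, ∀ C : Set (Lp Y 2 μ), IsClosed C → Convex ℝ C →
      (∀ᶠ n in atTop, u n ∈ C) → v ∈ C := by
  -- The norm on `Y` is arbitrary, so `L²` is made a Hilbert space through a linear isomorphism of
  -- `Y` with a Euclidean space. Closed convex sets are preserved.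
  set e := toEuclidean (E := Y)
  set T := e.toContinuousLinearMap.compLpL 2 μ
  set T' := e.symm.toContinuousLinearMap.compLpL 2 μ
  have hTT : ∀ w, T' (T w) = w := fun w => by
    refine Lp.ext ?_
    filter_upwards [e.symm.toContinuousLinearMap.coeFn_compLpL (T w),
      e.toContinuousLinearMap.coeFn_compLpL w] with t h1 h2
    rw [h1, h2]
    simp
  obtain ⟨v, hv⟩ := exists_mem_of_isClosed_of_convex (u := fun n => T (u n)) (R := ‖T‖ * R)
    fun n => (T.le_opNorm _).trans (mul_le_mul_of_nonneg_left (hu n) (norm_nonneg _))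
  refine ⟨T' v, fun C hC hCc hev => ?_⟩
  refine hv (T' ⁻¹' C) (hC.preimage T'.continuous) (hCc.linear_preimage T'.toLinearMap) ?_
  filter_upwards [hev] with n hn
  rwa [mem_preimage, hTT]

-- `L²` convergence gives almost everywhere convergence of a subsequence, and pointwise bounds
-- survive that.
open Filter in
theorem isClosed_setOf_ae_norm_le {μ : Measure ℝ} :
    IsClosed {w : Lp Y 2 μ | ∀ᵐ t ∂μ, ‖w t‖ ≤ M} := by
  refine IsSeqClosed.isClosed fun w w₀ hw hlim => ?_
  obtain ⟨ns, -, hns⟩ := (tendstoInMeasure_of_tendsto_Lp hlim).exists_seq_tendsto_ae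
  have hall : ∀ᵐ t ∂μ, ∀ n, ‖w n t‖ ≤ M := ae_all_iff.2 hw
  filter_upwards [hns, hall] with t ht h
  exact le_of_tendsto ht.norm (Eventually.of_forall fun i => h (ns i))

theorem convex_setOf_ae_norm_le {μ : Measure ℝ} :
    Convex ℝ {w : Lp Y 2 μ | ∀ᵐ t ∂μ, ‖w t‖ ≤ M} := by
  intro w hw w' hw' α β hα hβ hαβ
  filter_upwards [hw, hw', Lp.coeFn_add (α • w) (β • w'), Lp.coeFn_smul α w,
    Lp.coeFn_smul β w'] with t h h' e₁ e₂ e₃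
  rw [e₁, Pi.add_apply, e₂, e₃, Pi.smul_apply, Pi.smul_apply]
  have := (convex_closedBall (0 : Y) M) (mem_closedBall_zero_iff.2 h)
    (mem_closedBall_zero_iff.2 h') hα hβ hαβ
  exact mem_closedBall_zero_iff.1 this

theorem memLp_two_indicator {E : Type*} [NormedAddCommGroup E] {A : ℝ → E} {μ : Measure ℝ}
    {s : Set ℝ} (hs : MeasurableSet s) (h : MemLp A 2 μ) : MemLp (s.indicator A) 2 μ :=
  h.indicator hs

/-- Continuity of these functionals makes the preimages of closed balls closed and convex, hence
admissible tests for the weak limit. -/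
theorem exists_clm_integral {A : ℝ → Y →L[ℝ] X} (hA : ContinuousOn A (Icc a b)) {t : ℝ}
    (ht : t ∈ Icc a b) :
    ∃ L : Lp Y 2 (volume.restrict (Icc a b)) →L[ℝ] X,
      ∀ w, L w = ∫ s in a..t, A s (w s) := by
  have hmem : MemLp ((Icc a t).indicator A) 2 (volume.restrict (Icc a b)) := by
    obtain ⟨K, hK⟩ := isCompact_Icc.exists_bound_of_continuousOn hA
    have : MemLp A 2 (volume.restrict (Icc a b)) := by
      refine MemLp.of_bound (hA.aestronglyMeasurable measurableSet_Icc) K ?_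
      filter_upwards [ae_restrict_mem measurableSet_Icc] with s hs using hK s hs
    exact memLp_two_indicator measurableSet_Icc this
  refine ⟨(ContinuousLinearMap.id ℝ (Y →L[ℝ] X)).lpPairing (volume.restrict (Icc a b)) 2 2
    hmem.toLp, fun w => ?_⟩
  rw [ContinuousLinearMap.lpPairing_eq_integral, intervalIntegral.integral_of_le ht.1,
    ← integral_Icc_eq_integral_Ioc]
  simp only [ContinuousLinearMap.coe_id', id_eq]
  have hsub : Icc a t ⊆ Icc a b := Icc_subset_Icc_right ht.2
  have : ∫ s in Icc a t, A s (w s) =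
      ∫ s in Icc a t, A s (w s) ∂(volume.restrict (Icc a b)) := by
    rw [Measure.restrict_restrict measurableSet_Icc, inter_eq_left.2 hsub]
  rw [this, ← integral_indicator (s := Icc a t) measurableSet_Icc]
  refine integral_congr_ae ?_
  filter_upwards [hmem.coeFn_toLp] with s hs
  rw [hs]
  by_cases h : s ∈ Icc a t <;> simp [h]

open Filter in
/-- Weak sequential compactness of the set of controls bounded by `M`, tested against the maps
`u ↦ ∫ A u` and the `L²`-norm. -/
theorem exists_weak_limit {u : ℕ → ℝ → Y} {A : ℝ → Y →L[ℝ] X} {z : ℝ → X} {β : ENNReal}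
    (hm : ∀ n, AEStronglyMeasurable (u n) (volume.restrict (Icc a b)))
    (hM : ∀ n, ∀ᵐ t ∂(volume.restrict (Icc a b)), ‖u n t‖ ≤ M)
    (hA : ContinuousOn A (Icc a b))
    (hz : ∀ t ∈ Icc a b, Tendsto (fun n => ∫ s in a..t, A s (u n s)) atTop (𝓝 (z t)))
    (hβ : Tendsto (fun n => eLpNorm (u n) 2 (volume.restrict (Icc a b))) atTop (𝓝 β)) :
    ∃ v : ℝ → Y, AEStronglyMeasurable v (volume.restrict (Icc a b)) ∧
      (∀ᵐ t ∂(volume.restrict (Icc a b)), ‖v t‖ ≤ M) ∧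
      eLpNorm v 2 (volume.restrict (Icc a b)) ≤ β ∧
      ∀ t ∈ Icc a b, ∫ s in a..t, A s (v s) = z t := by
  set μ := volume.restrict (Icc a b) with hμ
  have hmem : ∀ n, MemLp (u n) 2 μ := fun n => MemLp.of_bound (hm n) M (hM n)
  set w : ℕ → Lp Y 2 μ := fun n => (hmem n).toLp with hw
  have hwu : ∀ n, ⇑(w n) =ᵐ[μ] u n := fun n => (hmem n).coeFn_toLp
  have hwM : ∀ n, ∀ᵐ t ∂μ, ‖w n t‖ ≤ M := fun n => by
    filter_upwards [hwu n, hM n] with t h1 h2 using by rwa [h1]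
  obtain ⟨R, hR⟩ : ∃ R, ∀ n, ‖w n‖ ≤ R :=
    ⟨_, fun n => Lp.norm_le_of_ae_bound (C := max M 0) (le_max_right _ _)
      ((hwM n).mono fun t ht => ht.trans (le_max_left _ _))⟩
  obtain ⟨v, hv⟩ := exists_mem_Lp_of_isClosed_of_convex hR
  refine ⟨v, Lp.aestronglyMeasurable v, hv _ isClosed_setOf_ae_norm_le convex_setOf_ae_norm_le
    (Eventually.of_forall hwM), ?_, fun t ht => ?_⟩
  · rcases eq_or_ne β ⊤ with h | h
    · rw [h]; exact le_top
    have hwβ : Tendsto (fun n => ‖w n‖) atTop (𝓝 β.toReal) := by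
      have := (ENNReal.tendsto_toReal h).comp hβ
      refine this.congr fun n => ?_
      rw [hw, Lp.norm_toLp]
      rfl
    have hvn : ‖v‖ ≤ β.toReal := by
      -- Weak lower semicontinuity of the norm: slightly larger closed balls contain a tail, and so
      -- contain the limit.
      refine le_of_forall_pos_le_add fun ε hε => ?_
      have := hv (Metric.closedBall 0 (β.toReal + ε)) Metric.isClosed_closedBall
        (convex_closedBall _ _) (by
          filter_upwards [hwβ.eventually_le_const (lt_add_of_pos_right _ hε)] with n hn
          exact mem_closedBall_zero_iff.2 hn)
      exact mem_closedBall_zero_iff.1 this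
    rw [Lp.norm_def] at hvn
    exact (ENNReal.toReal_le_toReal (Lp.eLpNorm_ne_top v) h).1 hvn
  · obtain ⟨L, hL⟩ := exists_clm_integral hA ht
    rw [← hL]
    have hLw : Tendsto (fun n => L (w n)) atTop (𝓝 (z t)) := by
      refine (hz t ht).congr fun n => ?_
      rw [hL, intervalIntegral.integral_of_le ht.1, intervalIntegral.integral_of_le ht.1]
      refine integral_congr_ae ?_
      filter_upwards [ae_restrict_of_ae_restrict_of_subset
        (Ioc_subset_Icc_self.trans (Icc_subset_Icc_right ht.2)) (hwu n)] with s hs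
      rw [hs]
    refine eq_of_forall_dist_le fun ε hε => ?_
    exact hv (L ⁻¹' Metric.closedBall (z t) ε)
      (Metric.isClosed_closedBall.preimage L.continuous)
      ((convex_closedBall _ _).linear_preimage L.toLinearMap) (by
        filter_upwards [Metric.tendsto_nhds.1 hLw ε hε] with n hn
        exact hn.le)

end FunnelMPC

namespace FunnelMPC

/-! ### Auxiliary facts: the barrier term of the stage cost, compactness, `C¹` maps -/

/-- The barrier term `1 / (1 - r²) - 1`, with the value `∞` for `r ≥ 1`. -/
noncomputable def barrier (r : ℝ) : ENNReal := (ENNReal.ofReal (1 - r ^ 2))⁻¹ - 1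

/-- Continuity holds across `r = 1` as well: `ENNReal.ofReal` truncates negative values to zero and
the inverse of zero is `∞`. This allows Fatou's lemma before the limit is known to be in the funnel.
-/
theorem continuous_barrier : Continuous barrier := by
  unfold barrier
  refine (ENNReal.continuous_sub_right 1).comp ?_
  exact (ENNReal.continuous_ofReal.comp (by fun_prop)).inv

theorem barrier_eq {r : ℝ} (h0 : 0 ≤ r) (h1 : r < 1) :
    barrier r = ENNReal.ofReal (1 / (1 - r ^ 2) - 1) := by
  have : 0 < 1 - r ^ 2 := by nlinarith
  rw [barrier, ENNReal.ofReal_sub _ zero_le_one, ENNReal.ofReal_one, one_div,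
    ENNReal.ofReal_inv_of_pos this]

theorem one_div_one_sub_sq_nonneg {r : ℝ} (h0 : 0 ≤ r) (h1 : r < 1) :
    0 ≤ 1 / (1 - r ^ 2) - 1 := by
  have h : 0 < 1 - r ^ 2 := by nlinarith
  rw [sub_nonneg, le_div_iff₀ h]
  nlinarith [sq_nonneg r]

/-- A Lipschitz function that starts below `1` stays below `1` if the integral of a function that
dominates its barrier term is finite. -/
theorem lt_one_of_lintegral_ne_top {a b L : ℝ} {r : ℝ → ℝ} {ζ : ℝ → ENNReal} (hL : 0 < L)
    (hr : ∀ s ∈ Icc a b, ∀ t ∈ Icc a b, |r t - r s| ≤ L * |t - s|)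
    (hr0 : ∀ t ∈ Icc a b, 0 ≤ r t) (hra : r a < 1)
    (hζ : ∀ t ∈ Icc a b, r t < 1 → ENNReal.ofReal (1 / (1 - r t ^ 2) - 1) ≤ ζ t)
    (hfin : ∫⁻ t in Icc a b, ζ t ≠ ⊤) : ∀ t ∈ Icc a b, r t < 1 := by
  by_contra! hex
  have hcont : ContinuousOn r (Icc a b) := by
    refine (LipschitzOnWith.of_dist_le_mul (K := L.toNNReal) fun s hs t ht => ?_).continuousOn
    rw [Real.dist_eq, Real.dist_eq, Real.coe_toNNReal L hL.le]
    exact hr t ht s hs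
  -- The infimum `τ` of this compact set is the first time at which `r` reaches `1`.
  set K := Icc a b ∩ r ⁻¹' Ici 1 with hK
  have hKc : IsCompact K :=
    isCompact_Icc.of_isClosed_subset (hcont.preimage_isClosed_of_isClosed isClosed_Icc isClosed_Ici)
      inter_subset_left
  obtain ⟨t₁, ht₁, ht₁'⟩ := hex
  have hmem : sInf K ∈ K := hKc.sInf_mem ⟨t₁, ht₁, ht₁'⟩
  set τ := sInf K
  have hτI : τ ∈ Icc a b := hmem.1
  have hτ1 : 1 ≤ r τ := hmem.2
  have haτ : a < τ := lt_of_le_of_ne hτI.1 fun h => by rw [h] at hra; linarith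
  have hbelow : ∀ t ∈ Ioo a τ, r t < 1 := fun t ht => by
    by_contra! h
    exact absurd (csInf_le hKc.bddBelow
      (⟨⟨ht.1.le, ht.2.le.trans hτI.2⟩, h⟩ : t ∈ K)) (not_le.2 ht.2)
  have hsub : Ioo a τ ⊆ Icc a b := fun t ht => ⟨ht.1.le, ht.2.le.trans hτI.2⟩
  -- Before `τ`, `1 - r² = (1 - r)(1 + r) ≤ 2 L (τ - t)`, so `1 / (τ - t)` is dominated by the
  -- barrier. Its integrability up to `τ` is the contradiction.
  have hpt : ∀ t ∈ Ioo a τ, ‖(t - τ)⁻¹‖ₑ ≤ ENNReal.ofReal (2 * L) * (ζ t + 1) := fun t ht => by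
    have h1 := hbelow t ht
    have h0 := hr0 t (hsub ht)
    have hd : 0 < τ - t := sub_pos.2 ht.2
    have hlip := hr t (hsub ht) τ hτI
    rw [abs_of_pos hd] at hlip
    have hlip' : 1 - r t ≤ L * (τ - t) := by linarith [le_abs_self (r τ - r t)]
    have hq : 0 < 1 - r t ^ 2 := by nlinarith
    have hq' : 1 - r t ^ 2 ≤ 2 * L * (τ - t) := by nlinarith
    have hreal : (τ - t)⁻¹ ≤ 2 * L * ((1 / (1 - r t ^ 2) - 1) + 1) := by
      rw [sub_add_cancel, mul_one_div, inv_eq_one_div, div_le_div_iff₀ hd hq]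
      linarith
    calc ‖(t - τ)⁻¹‖ₑ = ENNReal.ofReal ((τ - t)⁻¹) := by
          rw [← ofReal_norm, norm_inv, Real.norm_eq_abs, abs_sub_comm, abs_of_pos hd]
      _ ≤ ENNReal.ofReal (2 * L * ((1 / (1 - r t ^ 2) - 1) + 1)) := ENNReal.ofReal_le_ofReal hreal
      _ = ENNReal.ofReal (2 * L) * (ENNReal.ofReal (1 / (1 - r t ^ 2) - 1) + 1) := by
          rw [ENNReal.ofReal_mul (by positivity),
            ENNReal.ofReal_add (one_div_one_sub_sq_nonneg h0 h1) zero_le_one, ENNReal.ofReal_one]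
      _ ≤ _ := by gcongr; exact hζ t (hsub ht) h1
  have hlt : ∫⁻ t in Ioo a τ, ‖(t - τ)⁻¹‖ₑ < ⊤ := by
    calc ∫⁻ t in Ioo a τ, ‖(t - τ)⁻¹‖ₑ
        ≤ ∫⁻ t in Ioo a τ, ENNReal.ofReal (2 * L) * (ζ t + 1) :=
          setLIntegral_mono' measurableSet_Ioo hpt
      _ = ENNReal.ofReal (2 * L) * ((∫⁻ t in Ioo a τ, ζ t) + volume (Ioo a τ)) := by
          rw [lintegral_const_mul' _ _ ENNReal.ofReal_ne_top, lintegral_add_right _ measurable_const]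
          simp
      _ < ⊤ := by
          refine ENNReal.mul_lt_top ENNReal.ofReal_lt_top (ENNReal.add_lt_top.2 ⟨?_, by simp⟩)
          exact (lintegral_mono_set hsub).trans_lt (lt_top_iff_ne_top.2 hfin)
  have hint : IntervalIntegrable (fun t => (t - τ)⁻¹) volume a τ := by
    rw [intervalIntegrable_iff_integrableOn_Ioo_of_le haτ.le]
    exact ⟨(measurable_id.sub_const τ).inv.aestronglyMeasurable, hlt⟩
  rcases intervalIntegrable_sub_inv_iff.1 hint with h | h
  · exact haτ.ne h
  · exact h right_mem_uIcc

variable {X Y : Type*} [NormedAddCommGroup X] [NormedSpace ℝ X] [FiniteDimensional ℝ X]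
  [NormedAddCommGroup Y] [NormedSpace ℝ Y]

theorem exists_bound_and_lipschitz_of_contDiff {F : X → Y} (hF : ContDiff ℝ 1 F) (R : ℝ) :
    ∃ C : ℝ, 0 ≤ C ∧ (∀ z, ‖z‖ ≤ R → ‖F z‖ ≤ C) ∧
      ∀ z z', ‖z‖ ≤ R → ‖z'‖ ≤ R → ‖F z - F z'‖ ≤ C * ‖z - z'‖ := by
  obtain ⟨C₁, hC₁⟩ := (isCompact_closedBall (0 : X) R).exists_bound_of_continuousOn
    hF.continuous.continuousOn
  obtain ⟨K, hK⟩ := hF.contDiffOn.exists_lipschitzOnWith one_ne_zero (convex_closedBall (0 : X) R)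
    (isCompact_closedBall (0 : X) R)
  refine ⟨max (max C₁ K) 0, le_max_right _ _, fun z hz => ?_, fun z z' hz hz' => ?_⟩
  · exact (hC₁ z (mem_closedBall_zero_iff.2 hz)).trans ((le_max_left _ _).trans (le_max_left _ _))
  · have := hK.dist_le_mul z (mem_closedBall_zero_iff.2 hz) z' (mem_closedBall_zero_iff.2 hz')
    rw [dist_eq_norm, dist_eq_norm] at this
    exact this.trans (mul_le_mul_of_nonneg_right
      ((le_max_right _ _).trans (le_max_left _ _)) (norm_nonneg _))

open Filter in
/-- A bounded and equi-Lipschitz sequence of functions on `[a, b]` has a uniformly convergent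
subsequence. -/
theorem exists_tendstoUniformlyOn_subseq {a b R L : ℝ} (hab : a ≤ b) {x : ℕ → ℝ → X}
    (hR : ∀ n, ∀ t ∈ Icc a b, ‖x n t‖ ≤ R)
    (hL : ∀ n, ∀ s ∈ Icc a b, ∀ t ∈ Icc a b, ‖x n t - x n s‖ ≤ L * |t - s|) :
    ∃ (y : ℝ → X) (ψ : ℕ → ℕ), StrictMono ψ ∧
      TendstoUniformlyOn (fun n => x (ψ n)) y atTop (Icc a b) := by
  have hlip : ∀ n, LipschitzWith L.toNNReal ((Icc a b).domRestrict (x n)) := fun n => by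
    refine LipschitzWith.of_dist_le_mul fun s t => ?_
    rw [dist_eq_norm, Subtype.dist_eq, Real.dist_eq]
    exact (hL n t t.2 s s.2).trans
      (mul_le_mul_of_nonneg_right (Real.le_coe_toNNReal L) (abs_nonneg _))
  set F : ℕ → BoundedContinuousFunction (Icc a b) X := fun n =>
    BoundedContinuousFunction.mkOfCompact ⟨(Icc a b).domRestrict (x n), (hlip n).continuous⟩
  have hcomp : IsCompact (closure (range F)) := by
    refine BoundedContinuousFunction.arzela_ascoli (Metric.closedBall (0 : X) R)
      (isCompact_closedBall _ _) (range F) ?_ ?_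
    · rintro _ t ⟨n, rfl⟩
      exact mem_closedBall_zero_iff.2 (hR n t t.2)
    · refine (LipschitzWith.uniformEquicontinuous _ L.toNNReal ?_).equicontinuous
      rintro ⟨_, n, rfl⟩
      exact hlip n
  obtain ⟨y, -, ψ, hψ, hlim⟩ := hcomp.tendsto_subseq fun n => subset_closure ⟨n, rfl⟩
  refine ⟨IccExtend hab y, ψ, hψ, ?_⟩
  rw [BoundedContinuousFunction.tendsto_iff_tendstoUniformly, Metric.tendstoUniformly_iff] at hlim
  rw [Metric.tendstoUniformlyOn_iff]
  intro ε hε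
  filter_upwards [hlim ε hε] with n hn t ht
  rw [IccExtend_of_mem hab _ ht]
  exact hn ⟨t, ht⟩

end FunnelMPC

namespace FunnelMPC

namespace ControlSystem

variable {X Y : Type*}
  [NormedAddCommGroup X] [NormedSpace ℝ X] [FiniteDimensional ℝ X]
  [NormedAddCommGroup Y] [NormedSpace ℝ Y] [FiniteDimensional ℝ Y]
  {S : ControlSystem X Y} {φ : ℝ → ℝ} {yref : ℝ → Y} {a b lam M T : ℝ} {x₀ : X}
  {x : ℝ → X} {u : ℝ → Y}

/-! ### Responses and their cost -/

theorem isAdmissible_iff (hM : 0 ≤ M) :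
    IsAdmissible Y M T a u ↔ AEStronglyMeasurable u (volume.restrict (Icc a (a + T))) ∧
      ∀ᵐ t ∂(volume.restrict (Icc a (a + T))), ‖u t‖ ≤ M := by
  constructor
  · rintro ⟨hu, hle⟩
    refine ⟨hu.1, ?_⟩
    filter_upwards [ae_le_eLpNormEssSup (f := u) (μ := volume.restrict (Icc a (a + T)))] with t ht
    rw [← eLpNorm_exponent_top] at ht
    have := ht.trans hle
    rwa [← ofReal_norm, ENNReal.ofReal_le_ofReal_iff hM] at this
  · rintro ⟨hm, hle⟩
    refine ⟨MemLp.of_bound hm M hle, ?_⟩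
    rw [eLpNorm_exponent_top]
    exact eLpNormEssSup_le_of_ae_bound hle

theorem isLocallyLipschitzField_rhs (hu : ∀ᵐ t ∂(volume.restrict (Icc a b)), ‖u t‖ ≤ M) :
    IsLocallyLipschitzField (S.rhs u) a b := by
  intro R
  obtain ⟨C₁, h0, hb₁, hl₁⟩ := exists_bound_and_lipschitz_of_contDiff S.contDiff_f R
  obtain ⟨C₂, h0', hb₂, hl₂⟩ := exists_bound_and_lipschitz_of_contDiff S.contDiff_g R
  refine ⟨C₁ + C₂ * M, ?_⟩
  filter_upwards [hu] with t ht
  refine ⟨fun z hz => ?_, fun z z' hz hz' => ?_⟩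
  · refine (norm_add_le _ _).trans (add_le_add (hb₁ z hz) ?_)
    exact ((S.g z).le_opNorm _).trans (mul_le_mul (hb₂ z hz) ht (norm_nonneg _) h0')
  · have e : S.rhs u t z - S.rhs u t z' = (S.f z - S.f z') + (S.g z - S.g z') (u t) := by
      simp only [rhs, sub_apply]; abel
    rw [e, add_mul]
    refine (norm_add_le _ _).trans (add_le_add (hl₁ z z' hz hz') ?_)
    refine ((S.g z - S.g z').le_opNorm _).trans ?_
    calc ‖S.g z - S.g z'‖ * ‖u t‖ ≤ (C₂ * ‖z - z'‖) * M :=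
          mul_le_mul (hl₂ z z' hz hz') ht (norm_nonneg _) (by positivity)
      _ = C₂ * M * ‖z - z'‖ := by ring

theorem response_eq (h : IsSolutionOn (S.rhs u) a b x₀ x) (hab : a ≤ b)
    (hu : ∀ᵐ t ∂(volume.restrict (Icc a b)), ‖u t‖ ≤ M) :
    ∀ t ∈ Icc a b, S.response a b x₀ u t = x t := by
  have hex : ∃ x, IsSolutionOn (S.rhs u) a b x₀ x := ⟨x, h⟩
  rw [response, dif_pos hex]
  exact hex.choose_spec.unique h hab (isLocallyLipschitzField_rhs hu)

variable (S φ yref) in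
/-- The relative tracking error `φ(t) ‖h(x(t)) - y_ref(t)‖` along `x`. -/
noncomputable def ratio (x : ℝ → X) (t : ℝ) : ℝ := φ t * ‖S.h (x t) - yref t‖

theorem ratio_nonneg (hφ : φ ∈ funnelFunctions) {t : ℝ} (ht : 0 ≤ t) :
    0 ≤ ratio S φ yref x t := by
  obtain ⟨-, c, hc, hcφ⟩ := hφ
  exact mul_nonneg (hc.le.trans (hcφ t ht)) (norm_nonneg _)

/-- Bounded controls make the solution Lipschitz, and `h` is Lipschitz on the ball that contains it.
This is the hypothesis of `lt_one_of_lintegral_ne_top`. -/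
theorem exists_ratio_lipschitz (hφ : φ ∈ funnelFunctions) (hyref : MemW1Infty yref)
    (ha : 0 ≤ a) (hab : a ≤ b) (h : IsSolutionOn (S.rhs u) a b x₀ x)
    (hu : ∀ᵐ t ∂(volume.restrict (Icc a b)), ‖u t‖ ≤ M) :
    ∃ L : ℝ, 0 < L ∧ ∀ s ∈ Icc a b, ∀ t ∈ Icc a b,
      |ratio S φ yref x t - ratio S φ yref x s| ≤ L * |t - s| := by
  obtain ⟨Lφ, hLφ0, hLφ⟩ := hφ.1.exists_lipschitz
  obtain ⟨Cφ, hCφ0, hCφ⟩ := hφ.1.exists_bound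
  obtain ⟨Ly, hLy0, hLy⟩ := hyref.exists_lipschitz
  obtain ⟨Cy, hCy0, hCy⟩ := hyref.exists_bound
  obtain ⟨R, hR⟩ := h.exists_bound hab
  obtain ⟨C, hC0, hCb, hCl⟩ := exists_bound_and_lipschitz_of_contDiff
    (S.contDiff_h.of_le one_le_two) R
  obtain ⟨K, hK⟩ := h.ae_norm_le hab (isLocallyLipschitzField_rhs hu)
  have hx := h.norm_sub_le hab hK
  refine ⟨Cφ * (C * |K| + Ly) + Lφ * (C + Cy) + 1, by positivity, fun s hs t ht => ?_⟩
  have hs0 := ha.trans hs.1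
  have ht0 := ha.trans ht.1
  have e : ratio S φ yref x t - ratio S φ yref x s =
      φ t * (‖S.h (x t) - yref t‖ - ‖S.h (x s) - yref s‖) +
      (φ t - φ s) * ‖S.h (x s) - yref s‖ := by simp only [ratio]; ring
  have h1 : |‖S.h (x t) - yref t‖ - ‖S.h (x s) - yref s‖| ≤ (C * |K| + Ly) * |t - s| := by
    refine (abs_norm_sub_norm_le _ _).trans ?_
    have e : S.h (x t) - yref t - (S.h (x s) - yref s) =
      (S.h (x t) - S.h (x s)) - (yref t - yref s) := by abel
    rw [e, add_mul]
    refine (_root_.norm_sub_le _ _).trans (add_le_add ?_ (hLy s t hs0 ht0))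
    refine (hCl _ _ (hR t ht) (hR s hs)).trans ?_
    rw [mul_assoc]
    refine mul_le_mul_of_nonneg_left ((hx s hs t ht).trans ?_) hC0
    exact mul_le_mul_of_nonneg_right (le_abs_self K) (abs_nonneg _)
  have h2 : ‖S.h (x s) - yref s‖ ≤ C + Cy :=
    (_root_.norm_sub_le _ _).trans (add_le_add (hCb _ (hR s hs)) (hCy s hs0))
  have h3 : |φ t| ≤ Cφ := hCφ t ht0
  have h4 : |φ t - φ s| ≤ Lφ * |t - s| := hLφ s t hs0 ht0
  rw [e]
  calc _ ≤ |φ t| * |‖S.h (x t) - yref t‖ - ‖S.h (x s) - yref s‖| +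
        |φ t - φ s| * ‖S.h (x s) - yref s‖ := by
        refine (abs_add_le _ _).trans (le_of_eq ?_)
        rw [abs_mul, abs_mul, abs_of_nonneg (norm_nonneg (S.h (x s) - yref s))]
    _ ≤ Cφ * ((C * |K| + Ly) * |t - s|) + (Lφ * |t - s|) * (C + Cy) := by gcongr
    _ = (Cφ * (C * |K| + Ly) + Lφ * (C + Cy)) * |t - s| := by ring
    _ ≤ _ := mul_le_mul_of_nonneg_right (by linarith) (abs_nonneg _)

theorem continuousOn_ratio (hφ : φ ∈ funnelFunctions) (hyref : MemW1Infty yref)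
    (ha : 0 ≤ a) (hx : ContinuousOn x (Icc a b)) :
    ContinuousOn (ratio S φ yref x) (Icc a b) := by
  have hsub : Icc a b ⊆ Ici 0 := fun t ht => mem_Ici.2 (ha.trans ht.1)
  exact (hφ.1.1.mono hsub).mul
    ((S.contDiff_h.continuous.comp_continuousOn hx).sub (hyref.1.mono hsub)).norm

theorem stageCost_eq {t : ℝ} {v : Y} (h : ratio S φ yref x t < 1) :
    S.stageCost φ yref lam t (x t) v =
      ((1 / (1 - ratio S φ yref x t ^ 2) - 1 + lam * ‖v‖ ^ 2 : ℝ) : EReal) := by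
  rw [stageCost, ratio, mul_pow, if_pos (show φ t * ‖S.h (x t) - yref t‖ ≠ 1 from ne_of_lt h)]

variable (S φ yref) in
/-- The cost of the trajectory `x` with control `u` inside the funnel. -/
noncomputable def trajectoryCost (lam a b : ℝ) (x : ℝ → X) (u : ℝ → Y) : ENNReal :=
  (∫⁻ t in Icc a b, barrier (ratio S φ yref x t)) +
    ENNReal.ofReal lam * eLpNorm u 2 (volume.restrict (Icc a b)) ^ 2

theorem lintegral_barrier_ne_top (hφ : φ ∈ funnelFunctions) (hyref : MemW1Infty yref)
    (ha : 0 ≤ a) (hx : ContinuousOn x (Icc a b)) (hr : ∀ t ∈ Icc a b, ratio S φ yref x t < 1) :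
    ∫⁻ t in Icc a b, barrier (ratio S φ yref x t) ≠ ⊤ := by
  rcases (Icc a b).eq_empty_or_nonempty with he | hne
  · simp [he]
  obtain ⟨τ, hτ, hmax⟩ := isCompact_Icc.exists_isMaxOn hne
    (continuous_barrier.comp_continuousOn (continuousOn_ratio (S := S) hφ hyref ha hx))
  have hfin : barrier (ratio S φ yref x τ) ≠ ⊤ := by
    rw [barrier_eq (ratio_nonneg hφ (ha.trans hτ.1)) (hr τ hτ)]
    exact ENNReal.ofReal_ne_top
  refine ((setLIntegral_mono' measurableSet_Icc fun t ht => hmax ht).trans_lt ?_).ne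
  simp only [Function.comp_apply, lintegral_const]
  exact ENNReal.mul_lt_top (lt_top_iff_ne_top.2 hfin) (by simp)

theorem eLpNorm_two_ne_top (hm : AEStronglyMeasurable u (volume.restrict (Icc a b)))
    (hu : ∀ᵐ t ∂(volume.restrict (Icc a b)), ‖u t‖ ≤ M) :
    eLpNorm u 2 (volume.restrict (Icc a b)) ≠ ⊤ :=
  (MemLp.of_bound hm M hu).2.ne

theorem trajectoryCost_ne_top (hφ : φ ∈ funnelFunctions) (hyref : MemW1Infty yref)
    (ha : 0 ≤ a) (hx : ContinuousOn x (Icc a b)) (hr : ∀ t ∈ Icc a b, ratio S φ yref x t < 1)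
    (hm : AEStronglyMeasurable u (volume.restrict (Icc a b)))
    (hu : ∀ᵐ t ∂(volume.restrict (Icc a b)), ‖u t‖ ≤ M) :
    trajectoryCost S φ yref lam a b x u ≠ ⊤ :=
  ENNReal.add_ne_top.2 ⟨lintegral_barrier_ne_top hφ hyref ha hx hr,
    ENNReal.mul_ne_top ENNReal.ofReal_ne_top (ENNReal.pow_ne_top (eLpNorm_two_ne_top hm hu))⟩

/-- Inside the funnel the stage cost is nonnegative, so the negative part drops out and the
minimization can be carried out in `ENNReal`. -/
theorem cost_eq (hφ : φ ∈ funnelFunctions) (hyref : MemW1Infty yref) (hlam : 0 ≤ lam)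
    (ha : 0 ≤ a) (hT : 0 ≤ T) (hM : 0 ≤ M) (hu : IsAdmissible Y M T a u)
    (hx : IsSolutionOn (S.rhs u) a (a + T) x₀ x)
    (hr : ∀ t ∈ Icc a (a + T), ratio S φ yref x t < 1) :
    S.cost φ yref lam T a x₀ u = (trajectoryCost S φ yref lam a (a + T) x u : EReal) := by
  have hab : a ≤ a + T := by linarith
  obtain ⟨hm, huM⟩ := (isAdmissible_iff hM).1 hu
  have hresp := response_eq hx hab huM
  set μ := volume.restrict (Icc a (a + T)) with hμ
  have hxc := hx.continuousOn hab
  have hrc := continuousOn_ratio (S := S) hφ hyref ha hxc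
  set ℓ : ℝ → ℝ := fun t => 1 / (1 - ratio S φ yref x t ^ 2) - 1 + lam * ‖u t‖ ^ 2 with hℓ
  set ζ : ℝ → EReal :=
    fun t => S.stageCost φ yref lam t (S.response a (a + T) x₀ u t) (u t) with hζ
  have hζℓ : ∀ t ∈ Icc a (a + T), ζ t = (ℓ t : EReal) := fun t ht => by
    simp only [hζ, hresp t ht]
    exact stageCost_eq (hr t ht)
  have hae : ζ =ᵐ[μ] fun t => (ℓ t : EReal) := by
    filter_upwards [ae_restrict_mem measurableSet_Icc] with t ht using hζℓ t ht
  have hpos : ∀ t ∈ Icc a (a + T), 0 ≤ ratio S φ yref x t := fun t ht =>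
    ratio_nonneg hφ (ha.trans ht.1)
  have hbm : AEMeasurable (fun t => barrier (ratio S φ yref x t)) μ :=
    (continuous_barrier.comp_continuousOn hrc).aemeasurable measurableSet_Icc
  have hℓm : AEMeasurable ℓ μ := by
    have h1 : AEMeasurable (fun t => 1 / (1 - ratio S φ yref x t ^ 2) - 1) μ :=
      (((hrc.aemeasurable measurableSet_Icc).pow_const 2).const_sub 1).const_div 1 |>.sub_const 1
    exact h1.add ((hm.norm.aemeasurable.pow_const 2).const_mul lam)
  have hℓ0 : ∀ t ∈ Icc a (a + T), 0 ≤ ℓ t := fun t ht =>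
    add_nonneg (one_div_one_sub_sq_nonneg (hpos t ht) (hr t ht)) (by positivity)
  have hint : ∫⁻ t, (ζ t).toENNReal ∂μ = trajectoryCost S φ yref lam a (a + T) x u := by
    have h2 : eLpNorm u 2 μ ^ 2 = ∫⁻ t, ‖u t‖ₑ ^ 2 ∂μ := by
      have := eLpNorm_nnreal_pow_eq_lintegral (f := u) (μ := μ) (p := 2) two_ne_zero
      simpa using this
    rw [trajectoryCost, h2, ← lintegral_const_mul' _ _ ENNReal.ofReal_ne_top,
      ← lintegral_add_left' hbm]
    refine lintegral_congr_ae ?_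
    filter_upwards [ae_restrict_mem measurableSet_Icc] with t ht
    rw [hζℓ t ht, EReal.real_coe_toENNReal, barrier_eq (hpos t ht) (hr t ht), hℓ,
      ENNReal.ofReal_add (one_div_one_sub_sq_nonneg (hpos t ht) (hr t ht)) (by positivity),
      ENNReal.ofReal_mul hlam, ENNReal.ofReal_pow (norm_nonneg _), ofReal_norm]
  have hneg : ∫⁻ t, (-ζ t).toENNReal ∂μ = 0 := by
    rw [lintegral_congr_ae (g := fun _ => 0), lintegral_zero]
    filter_upwards [ae_restrict_mem measurableSet_Icc] with t ht
    rw [hζℓ t ht, EReal.toENNReal_of_nonpos]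
    rw [← EReal.coe_neg]
    exact_mod_cast neg_nonpos.2 (hℓ0 t ht)
  have hq : QuasiIntegrable ζ μ :=
    ⟨hℓm.coe_real_ereal.congr hae.symm, Or.inr (by rw [hneg]; exact ENNReal.zero_ne_top)⟩
  rw [cost, if_pos ⟨⟨x, hx⟩, hq⟩, extIntegral, hint, hneg]
  simp

/-- Outside the funnel the stage cost may be negative, so controls whose trajectories leave it are
not excluded by sign. What excludes them is the barrier: the positive part of the cost would have to
be infinite at the crossing. -/
theorem exists_funnel_trajectory_of_cost_ne_top (hφ : φ ∈ funnelFunctions)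
    (hyref : MemW1Infty yref) (hlam : 0 ≤ lam) (ha : 0 ≤ a) (hT : 0 ≤ T) (hM : 0 ≤ M)
    (hx₀ : x₀ ∈ S.funnelStates φ yref a) (hu : IsAdmissible Y M T a u)
    (hc : S.cost φ yref lam T a x₀ u ≠ ⊤) :
    ∃ x, IsSolutionOn (S.rhs u) a (a + T) x₀ x ∧
      ∀ t ∈ Icc a (a + T), ratio S φ yref x t < 1 := by
  have hab : a ≤ a + T := by linarith
  obtain ⟨hm, huM⟩ := (isAdmissible_iff hM).1 hu
  rw [cost] at hc
  split_ifs at hc with h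
  · obtain ⟨⟨x, hx⟩, -, hq⟩ := h
    refine ⟨x, hx, ?_⟩
    have hresp := response_eq hx hab huM
    obtain ⟨L, hL, hrL⟩ := exists_ratio_lipschitz hφ hyref ha hab hx huM
    refine lt_one_of_lintegral_ne_top hL hrL (fun t ht => ratio_nonneg hφ (ha.trans ht.1)) ?_
      (ζ := fun t => (S.stageCost φ yref lam t (S.response a (a + T) x₀ u t) (u t)).toENNReal)
      (fun t ht hr => ?_) ?_
    · rw [ratio, hx.1]; exact hx₀
    · rw [hresp t ht, stageCost_eq hr, EReal.real_coe_toENNReal]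
      exact ENNReal.ofReal_le_ofReal (le_add_of_nonneg_right (by positivity))
    -- If the positive part had infinite integral, quasi-integrability would make the negative part
    -- finite, and the cost would be `∞`.
    · intro htop
      rw [htop] at hq
      have hN := hq.resolve_left (by simp)
      refine hc ?_
      rw [extIntegral, htop]
      lift (∫⁻ t in Icc a (a + T),
        (-S.stageCost φ yref lam t (S.response a (a + T) x₀ u t) (u t)).toENNReal) to NNReal
        using hN with N
      exact EReal.top_sub_coe (N : ℝ)
  · exact absurd rfl hc

end ControlSystem

end FunnelMPC

namespace FunnelMPC

namespace ControlSystem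

variable {X Y : Type*}
  [NormedAddCommGroup X] [NormedSpace ℝ X] [FiniteDimensional ℝ X]
  [NormedAddCommGroup Y] [NormedSpace ℝ Y] [FiniteDimensional ℝ Y]
  {S : ControlSystem X Y} {φ : ℝ → ℝ} {yref : ℝ → Y} {a b lam M T R : ℝ} {x₀ : X}
  {x : ℝ → X} {u : ℝ → Y}

/-! ### Existence of optimal controls -/

theorem integrableOn_clm_apply {A : ℝ → Y →L[ℝ] X} (hA : ContinuousOn A (Icc a b))
    (hm : AEStronglyMeasurable u (volume.restrict (Icc a b)))
    (hu : ∀ᵐ t ∂(volume.restrict (Icc a b)), ‖u t‖ ≤ M) :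
    IntegrableOn (fun t => A t (u t)) (Icc a b) := by
  obtain ⟨K, hK⟩ := isCompact_Icc.exists_bound_of_continuousOn hA
  refine ⟨(ContinuousLinearMap.id ℝ (Y →L[ℝ] X)).aestronglyMeasurable_comp₂
    (hA.aestronglyMeasurable measurableSet_Icc) hm, HasFiniteIntegral.of_bounded (C := K * M) ?_⟩
  filter_upwards [hu, ae_restrict_mem measurableSet_Icc] with t ht htI
  refine ((A t).le_opNorm _).trans (mul_le_mul (hK t htI) ht (norm_nonneg _) ?_)
  exact (norm_nonneg _).trans (hK t htI)

open Filter in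
/-- The uniform limit of trajectories with bounded controls is a trajectory, for a control whose
`L²`-norm does not exceed the limit of the `L²`-norms. -/
theorem exists_control_of_tendstoUniformlyOn {xs : ℕ → ℝ → X} {us : ℕ → ℝ → Y} {β : ENNReal}
    (hab : a ≤ b) (hM : 0 ≤ M)
    (hm : ∀ n, AEStronglyMeasurable (us n) (volume.restrict (Icc a b)))
    (hu : ∀ n, ∀ᵐ t ∂(volume.restrict (Icc a b)), ‖us n t‖ ≤ M)
    (hsol : ∀ n, IsSolutionOn (S.rhs (us n)) a b x₀ (xs n))
    (hR : ∀ n, ∀ t ∈ Icc a b, ‖xs n t‖ ≤ R)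
    (hlim : TendstoUniformlyOn xs x atTop (Icc a b))
    (hβ : Tendsto (fun n => eLpNorm (us n) 2 (volume.restrict (Icc a b))) atTop (𝓝 β)) :
    ∃ v : ℝ → Y, AEStronglyMeasurable v (volume.restrict (Icc a b)) ∧
      (∀ᵐ t ∂(volume.restrict (Icc a b)), ‖v t‖ ≤ M) ∧
      eLpNorm v 2 (volume.restrict (Icc a b)) ≤ β ∧ IsSolutionOn (S.rhs v) a b x₀ x := by
  have hxc : ContinuousOn x (Icc a b) :=
    hlim.continuousOn (Frequently.of_forall fun n => (hsol n).continuousOn hab)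
  have hxR : ∀ t ∈ Icc a b, ‖x t‖ ≤ R := fun t ht =>
    le_of_tendsto (hlim.tendsto_at ht).norm (Eventually.of_forall fun n => hR n t ht)
  have hgc : ContinuousOn (fun s => S.g (x s)) (Icc a b) :=
    S.contDiff_g.continuous.comp_continuousOn hxc
  have hfc : ContinuousOn (fun s => S.f (x s)) (Icc a b) :=
    S.contDiff_f.continuous.comp_continuousOn hxc
  obtain ⟨C₁, h0, hb₁, hl₁⟩ := exists_bound_and_lipschitz_of_contDiff S.contDiff_f R
  obtain ⟨C₂, h0', hb₂, hl₂⟩ := exists_bound_and_lipschitz_of_contDiff S.contDiff_g R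
  -- With the coefficient frozen at the limit `x`, the control enters linearly, which is what weak
  -- limits can handle. Replacing `xs n` by `x` costs at most `K` times the uniform distance.
  have hz : ∀ t ∈ Icc a b, Tendsto (fun n => ∫ s in a..t, S.g (x s) (us n s)) atTop
      (𝓝 (x t - x₀ - ∫ s in a..t, S.f (x s))) := by
    intro t ht
    rw [Metric.tendsto_nhds]
    intro ε hε
    set K := (C₂ * M + C₁) * (t - a) + 1 with hK
    have hta : 0 ≤ t - a := sub_nonneg.2 ht.1
    have hK0 : 0 < K := by positivity
    rw [Metric.tendstoUniformlyOn_iff] at hlim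
    filter_upwards [hlim (ε / K) (by positivity)] with n hn
    set δ := ε / K with hδ
    have hδ' : δ * K = ε := div_mul_cancel₀ _ hK0.ne'
    obtain ⟨D, hD⟩ := (hsol n).ae_norm_le hab (isLocallyLipschitzField_rhs (hu n))
    have hsub : Icc a t ⊆ Icc a b := Icc_subset_Icc_right ht.2
    have i₁ := (intervalIntegrable_iff_integrableOn_Icc_of_le ht.1).2
      ((integrableOn_clm_apply hgc (hm n) (hu n)).mono_set hsub)
    have i₂ := (intervalIntegrable_iff_integrableOn_Icc_of_le ht.1).2
      (((hsol n).integrableOn hD).mono_set hsub)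
    have i₃ : IntervalIntegrable (fun s => S.f (x s)) volume a t :=
      (hfc.mono hsub).intervalIntegrable_of_Icc ht.1
    have hw : ‖∫ s in a..t, (S.g (x s) (us n s) - S.rhs (us n) s (xs n s) + S.f (x s))‖ ≤
        ((C₂ * M + C₁) * δ) * (t - a) := by
      refine norm_intervalIntegral_le_of_ae ht.1 le_rfl ht.2 ?_
      filter_upwards [hu n, ae_restrict_mem measurableSet_Icc] with s hs hsI
      have e : S.g (x s) (us n s) - S.rhs (us n) s (xs n s) + S.f (x s) =
          (S.g (x s) - S.g (xs n s)) (us n s) + (S.f (x s) - S.f (xs n s)) := by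
        simp only [rhs, sub_apply]; abel
      have hd : ‖x s - xs n s‖ ≤ δ := by rw [← dist_eq_norm]; exact (hn s hsI).le
      rw [e, add_mul]
      refine (norm_add_le _ _).trans (add_le_add ?_ ?_)
      · refine ((S.g (x s) - S.g (xs n s)).le_opNorm _).trans ?_
        calc _ ≤ (C₂ * δ) * M := by
              refine mul_le_mul ?_ hs (norm_nonneg _) (mul_nonneg h0' ((norm_nonneg _).trans hd))
              exact (hl₂ _ _ (hxR s hsI) (hR n s hsI)).trans (mul_le_mul_of_nonneg_left hd h0')
          _ = C₂ * M * δ := by ring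
      · exact (hl₁ _ _ (hxR s hsI) (hR n s hsI)).trans (mul_le_mul_of_nonneg_left hd h0)
    rw [intervalIntegral.integral_add (i₁.sub i₂) i₃, intervalIntegral.integral_sub i₁ i₂] at hw
    have hxn := (hsol n).integral_eq hab hD t ht
    have e : (∫ s in a..t, S.g (x s) (us n s)) - (x t - x₀ - ∫ s in a..t, S.f (x s)) =
        ((∫ s in a..t, S.g (x s) (us n s)) - (∫ s in a..t, S.rhs (us n) s (xs n s)) +
          ∫ s in a..t, S.f (x s)) + (xs n t - x t) := by rw [hxn]; abel
    have hd : ‖xs n t - x t‖ < δ := by rw [← dist_eq_norm, dist_comm]; exact hn t ht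
    rw [dist_eq_norm, e]
    calc _ ≤ _ := norm_add_le _ _
      _ < ((C₂ * M + C₁) * δ) * (t - a) + δ := add_lt_add_of_le_of_lt hw hd
      _ = δ * K := by rw [hK]; ring
      _ = ε := hδ'
  obtain ⟨v, hvm, hvM, hvβ, hv⟩ := exists_weak_limit hm hu hgc hz hβ
  refine ⟨v, hvm, hvM, hvβ, ?_⟩
  have hint : IntegrableOn (fun t => S.rhs v t (x t)) (Icc a b) :=
    hfc.integrableOn_Icc.add (integrableOn_clm_apply hgc hvm hvM)
  refine isSolutionOn_of_integral_eq (C := C₁ + C₂ * M) hab hint ?_ fun t ht => ?_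
  · filter_upwards [hvM, ae_restrict_mem measurableSet_Icc] with t ht htI
    refine (norm_add_le _ _).trans (add_le_add (hb₁ _ (hxR t htI)) ?_)
    exact ((S.g (x t)).le_opNorm _).trans (mul_le_mul (hb₂ _ (hxR t htI)) ht (norm_nonneg _) h0')
  · have hsub : Icc a t ⊆ Icc a b := Icc_subset_Icc_right ht.2
    have i₁ := (intervalIntegrable_iff_integrableOn_Icc_of_le ht.1).2
      ((integrableOn_clm_apply hgc hvm hvM).mono_set hsub)
    have i₃ : IntervalIntegrable (fun s => S.f (x s)) volume a t :=
      (hfc.mono hsub).intervalIntegrable_of_Icc ht.1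
    simp only [rhs]
    rw [intervalIntegral.integral_add i₃ i₁, hv t ht]
    abel

variable (S φ yref) in
/-- `x` is a trajectory on `[a, b]` for the control `u`, bounded by `M`, inside the funnel. -/
structure IsFunnelTrajectory (M a b : ℝ) (x₀ : X) (x : ℝ → X) (u : ℝ → Y) : Prop where
  aestronglyMeasurable : AEStronglyMeasurable u (volume.restrict (Icc a b))
  ae_norm_le : ∀ᵐ t ∂(volume.restrict (Icc a b)), ‖u t‖ ≤ M
  isSolutionOn : IsSolutionOn (S.rhs u) a b x₀ x
  ratio_lt_one : ∀ t ∈ Icc a b, ratio S φ yref x t < 1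

-- Direct method: the a priori bound `R` makes a minimizing sequence of trajectories equi-Lipschitz,
-- hence compact.
open Filter in
theorem exists_trajectoryCost_le (hφ : φ ∈ funnelFunctions) (hyref : MemW1Infty yref)
    (ha : 0 ≤ a) (hab : a ≤ b) (hM : 0 ≤ M)
    (hfeas : ∃ x u, IsFunnelTrajectory S φ yref M a b x₀ x u)
    (hR : ∀ x u, IsFunnelTrajectory S φ yref M a b x₀ x u → ∀ t ∈ Icc a b, ‖x t‖ ≤ R) :
    ∃ x u, IsFunnelTrajectory S φ yref M a b x₀ x u ∧
      ∀ x' u', IsFunnelTrajectory S φ yref M a b x₀ x' u' →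
        trajectoryCost S φ yref lam a b x u ≤ trajectoryCost S φ yref lam a b x' u' := by
  set μ := volume.restrict (Icc a b) with hμ
  set V : Set ENNReal := {c | ∃ x u, IsFunnelTrajectory S φ yref M a b x₀ x u ∧
    trajectoryCost S φ yref lam a b x u = c} with hV
  have hVne : V.Nonempty := by
    obtain ⟨x, u, h⟩ := hfeas
    exact ⟨_, x, u, h, rfl⟩
  have hVfin : sInf V ≠ ⊤ := by
    obtain ⟨x, u, h⟩ := hfeas
    have hmem : trajectoryCost S φ yref lam a b x u ∈ V := ⟨x, u, h, rfl⟩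
    refine ((sInf_le hmem).trans_lt (lt_top_iff_ne_top.2 ?_)).ne
    exact trajectoryCost_ne_top hφ hyref ha (h.isSolutionOn.continuousOn hab) h.ratio_lt_one
      h.aestronglyMeasurable h.ae_norm_le
  obtain ⟨c, -, hc, hcV⟩ := exists_seq_tendsto_sInf hVne (OrderBot.bddBelow V)
  choose xs us htraj hcost using hcV
  obtain ⟨C₁, h0, hb₁, -⟩ := exists_bound_and_lipschitz_of_contDiff S.contDiff_f R
  obtain ⟨C₂, h0', hb₂, -⟩ := exists_bound_and_lipschitz_of_contDiff S.contDiff_g R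
  have hspeed : ∀ n, ∀ᵐ t ∂μ, ‖S.rhs (us n) t (xs n t)‖ ≤ C₁ + C₂ * M := fun n => by
    filter_upwards [(htraj n).ae_norm_le, ae_restrict_mem measurableSet_Icc] with t ht htI
    have := hR _ _ (htraj n) t htI
    refine (norm_add_le _ _).trans (add_le_add (hb₁ _ this) ?_)
    exact ((S.g _).le_opNorm _).trans (mul_le_mul (hb₂ _ this) ht (norm_nonneg _) h0')
  obtain ⟨x, ψ, hψ, hlim⟩ := exists_tendstoUniformlyOn_subseq hab
    (fun n => hR _ _ (htraj n)) (fun n => (htraj n).isSolutionOn.norm_sub_le hab (hspeed n))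
  -- Compactness of `[0, ∞]` lets the control energy converge along a further subsequence, so the
  -- barrier part converges by itself.
  obtain ⟨β, -, χ, hχ, hβ⟩ := isCompact_univ.tendsto_subseq
    (x := fun n => eLpNorm (us (ψ n)) 2 μ) fun n => mem_univ _
  have hlim' : TendstoUniformlyOn (fun n => xs (ψ (χ n))) x atTop (Icc a b) := fun s hs =>
    hχ.tendsto_atTop.eventually (hlim s hs)
  obtain ⟨v, hvm, hvM, hvβ, hv⟩ := exists_control_of_tendstoUniformlyOn hab hM
    (fun n => (htraj (ψ (χ n))).aestronglyMeasurable) (fun n => (htraj (ψ (χ n))).ae_norm_le)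
    (fun n => (htraj (ψ (χ n))).isSolutionOn) (fun n => hR _ _ (htraj (ψ (χ n)))) hlim' hβ
  have hc' : Tendsto (fun n => c (ψ (χ n))) atTop (𝓝 (sInf V)) :=
    hc.comp (hψ.tendsto_atTop.comp hχ.tendsto_atTop)
  set B : ℕ → ENNReal := fun n => ENNReal.ofReal lam * eLpNorm (us (ψ (χ n))) 2 μ ^ 2 with hB
  set Bβ := ENNReal.ofReal lam * β ^ 2 with hBβ
  have hBlim : Tendsto B atTop (𝓝 Bβ) :=
    ENNReal.Tendsto.const_mul (((ENNReal.continuous_pow 2).tendsto β).comp hβ)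
      (Or.inr ENNReal.ofReal_ne_top)
  have hBle : Bβ ≤ sInf V := le_of_tendsto_of_tendsto' hBlim hc' fun n => by
    rw [← hcost (ψ (χ n)), trajectoryCost]; exact le_add_self
  have hAlim : Tendsto (fun n => ∫⁻ t in Icc a b, barrier (ratio S φ yref (xs (ψ (χ n))) t))
      atTop (𝓝 (sInf V - Bβ)) := by
    refine (ENNReal.Tendsto.sub hc' hBlim (Or.inl hVfin)).congr fun n => ?_
    rw [← hcost (ψ (χ n)), trajectoryCost]
    exact ENNReal.add_sub_cancel_right (ENNReal.mul_ne_top ENNReal.ofReal_ne_top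
      (ENNReal.pow_ne_top (eLpNorm_two_ne_top (htraj _).aestronglyMeasurable
        (htraj _).ae_norm_le)))
  -- Fatou's lemma for the barrier part.
  have hA : ∫⁻ t in Icc a b, barrier (ratio S φ yref x t) ≤ sInf V - Bβ := by
    calc ∫⁻ t in Icc a b, barrier (ratio S φ yref x t)
        = ∫⁻ t in Icc a b, liminf
            (fun n => barrier (ratio S φ yref (xs (ψ (χ n))) t)) atTop := by
          refine setLIntegral_congr_fun measurableSet_Icc fun t ht => (Tendsto.liminf_eq ?_).symm
          refine (continuous_barrier.tendsto _).comp ?_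
          refine Tendsto.const_mul _ (Tendsto.norm (Tendsto.sub_const ?_ _))
          exact (S.contDiff_h.continuous.tendsto _).comp (hlim'.tendsto_at ht)
      _ ≤ _ := lintegral_liminf_le' fun n =>
          (continuous_barrier.comp_continuousOn (continuousOn_ratio hφ hyref ha
            ((htraj _).isSolutionOn.continuousOn hab))).aemeasurable measurableSet_Icc
      _ = _ := hAlim.liminf_eq
  -- The uniform limit by itself gives only `≤ 1`; finiteness of the barrier integral restores the
  -- strict inequality.
  have hratio : ∀ t ∈ Icc a b, ratio S φ yref x t < 1 := by
    obtain ⟨L, hL, hrL⟩ := exists_ratio_lipschitz hφ hyref ha hab hv hvM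
    have hr0 : ∀ t ∈ Icc a b, 0 ≤ ratio S φ yref x t := fun t ht =>
      ratio_nonneg hφ (ha.trans ht.1)
    refine lt_one_of_lintegral_ne_top hL hrL hr0 ?_ (fun t ht hr => ?_)
      (hA.trans_lt ((tsub_le_self).trans_lt (lt_top_iff_ne_top.2 hVfin))).ne
    · have := (htraj 0).ratio_lt_one a ⟨le_rfl, hab⟩
      rwa [ratio, (htraj 0).isSolutionOn.1, ← hv.1] at this
    · exact (barrier_eq (hr0 t ht) hr).ge
  refine ⟨x, v, ⟨hvm, hvM, hv, hratio⟩, fun x' u' h' => ?_⟩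
  calc trajectoryCost S φ yref lam a b x v ≤ (sInf V - Bβ) + Bβ := by
        rw [trajectoryCost, hBβ]; gcongr
    _ = sInf V := tsub_add_cancel_of_le hBle
    _ ≤ _ := sInf_le ⟨x', u', h', rfl⟩

theorem OCPSolvable.of_funnelTrajectory (hφ : φ ∈ funnelFunctions) (hyref : MemW1Infty yref)
    (hlam : 0 ≤ lam) (ha : 0 ≤ a) (hT : 0 ≤ T) (hM : 0 ≤ M)
    (hx₀ : x₀ ∈ S.funnelStates φ yref a)
    (hfeas : ∃ x u, IsFunnelTrajectory S φ yref M a (a + T) x₀ x u)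
    (hR : ∀ x u, IsFunnelTrajectory S φ yref M a (a + T) x₀ x u →
      ∀ t ∈ Icc a (a + T), ‖x t‖ ≤ R) :
    S.OCPSolvable φ yref lam M T a x₀ := by
  have hab : a ≤ a + T := by linarith
  obtain ⟨x, u, h, hmin⟩ := exists_trajectoryCost_le (lam := lam) hφ hyref ha hab hM hfeas hR
  have hadm : ∀ x u, IsFunnelTrajectory S φ yref M a (a + T) x₀ x u → IsAdmissible Y M T a u :=
    fun x u h => (isAdmissible_iff hM).2 ⟨h.aestronglyMeasurable, h.ae_norm_le⟩
  have hcost : ∀ x u, IsFunnelTrajectory S φ yref M a (a + T) x₀ x u →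
      S.cost φ yref lam T a x₀ u = (trajectoryCost S φ yref lam a (a + T) x u : EReal) :=
    fun x u h => cost_eq hφ hyref hlam ha hT hM (hadm x u h) h.isSolutionOn h.ratio_lt_one
  refine ⟨u, ⟨hadm x u h, fun v hv => ?_⟩, ?_⟩
  · by_cases hc : S.cost φ yref lam T a x₀ v = ⊤
    · rw [hc]; exact le_top
    · obtain ⟨x', hx', hr'⟩ :=
        exists_funnel_trajectory_of_cost_ne_top hφ hyref hlam ha hT hM hx₀ hv hc
      obtain ⟨hvm, hvM⟩ := (isAdmissible_iff hM).1 hv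
      have h' : IsFunnelTrajectory S φ yref M a (a + T) x₀ x' v := ⟨hvm, hvM, hx', hr'⟩
      rw [hcost x u h, hcost x' v h']
      exact_mod_cast hmin x' v h'
  · rw [hcost x u h]
    have := trajectoryCost_ne_top (lam := lam) hφ hyref ha (h.isSolutionOn.continuousOn hab)
      h.ratio_lt_one h.aestronglyMeasurable h.ae_norm_le
    rwa [Ne, EReal.coe_ennreal_eq_top_iff]

end ControlSystem

end FunnelMPC

namespace FunnelMPC

namespace ControlSystem

variable {X Y : Type*}
  [NormedAddCommGroup X] [NormedSpace ℝ X] [FiniteDimensional ℝ X]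
  [NormedAddCommGroup Y] [NormedSpace ℝ Y] [FiniteDimensional ℝ Y]
  {S : ControlSystem X Y} {φ : ℝ → ℝ} {yref : ℝ → Y} {a b lam M T R Cy c₁ : ℝ} {x₀ : X}
  {x : ℝ → X} {u : ℝ → Y} {Φ : X ≃ Y × Internal X Y} {p : Y × Internal X Y → Y}
  {q : Y × Internal X Y → Internal X Y}

/-! ### States with bounded internal dynamics -/

theorem isLocallyLipschitzField_internal (hq : ContDiff ℝ 1 q) {y : ℝ → Y}
    (hy : ∀ t ∈ Icc a b, ‖y t‖ ≤ Cy) :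
    IsLocallyLipschitzField (fun t z => q (y t, z)) a b := by
  intro R
  obtain ⟨C, -, hCb, hCl⟩ := exists_bound_and_lipschitz_of_contDiff hq (max Cy R)
  refine ⟨C, ?_⟩
  filter_upwards [ae_restrict_mem measurableSet_Icc] with t ht
  have hb : ∀ z : Internal X Y, ‖z‖ ≤ R → ‖(y t, z)‖ ≤ max Cy R := fun z hz => by
    rw [Prod.norm_mk]; exact max_le_max (hy t ht) hz
  refine ⟨fun z hz => hCb _ (hb z hz), fun z z' hz hz' => ?_⟩
  refine (hCl _ _ (hb z hz) (hb z' hz')).trans (le_of_eq ?_)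
  rw [Prod.mk_sub_mk, sub_self, Prod.norm_mk, norm_zero, max_eq_right (norm_nonneg _)]

theorem IsByrnesIsidoriForm.apply_eq (hΦ : S.IsByrnesIsidoriForm Φ p q) (x : X) :
    Φ x = (S.h x, (Φ x).2) :=
  Prod.ext (hΦ.fst_eq_output x) rfl

theorem absolutelyContinuousOnInterval_comp {E F : Type*} [NormedAddCommGroup E]
    [NormedSpace ℝ E] [FiniteDimensional ℝ E] [NormedAddCommGroup F] [NormedSpace ℝ F]
    [FiniteDimensional ℝ F] {G : E → F} (hG : ContDiff ℝ 1 G) {v : ℝ → E} {K : ℝ} (hab : a ≤ b)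
    (hv : ∀ s ∈ Icc a b, ∀ t ∈ Icc a b, ‖v t - v s‖ ≤ K * |t - s|)
    (hR : ∀ t ∈ Icc a b, ‖v t‖ ≤ R) :
    AbsolutelyContinuousOnInterval (fun t => G (v t)) a b := by
  obtain ⟨C, hC, -, hl⟩ := exists_bound_and_lipschitz_of_contDiff hG R
  refine absolutelyContinuousOnInterval_of_norm_sub_le (C := C * K) hab fun s hs t ht => ?_
  rw [mul_assoc]
  exact (hl _ _ (hR t ht) (hR s hs)).trans (mul_le_mul_of_nonneg_left (hv s hs t ht) hC)

theorem IsByrnesIsidoriForm.isSolutionOn_internal (hΦ : S.IsByrnesIsidoriForm Φ p q)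
    (hab : a ≤ b) (hx : IsSolutionOn (S.rhs u) a b x₀ x)
    (hu : ∀ᵐ t ∂(volume.restrict (Icc a b)), ‖u t‖ ≤ M) :
    IsSolutionOn (fun t z => q (S.h (x t), z)) a b (Φ x₀).2 fun t => (Φ (x t)).2 := by
  obtain ⟨K, hK⟩ := hx.ae_norm_le hab (isLocallyLipschitzField_rhs hu)
  obtain ⟨R, hR⟩ := hx.exists_bound hab
  refine ⟨by simp only [hx.1], ?_, ?_⟩
  · exact absolutelyContinuousOnInterval_comp (G := fun z => (Φ z).2) hΦ.contDiff_Φ.snd hab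
      (hx.norm_sub_le hab hK) hR
  · filter_upwards [hx.2.2] with t ht
    have hd : HasFDerivAt Φ (fderiv ℝ Φ (x t)) (x t) :=
      (hΦ.contDiff_Φ.differentiable one_ne_zero _).hasFDerivAt
    have := (hasFDerivAt_snd.comp_hasDerivAt t (hd.comp_hasDerivAt t ht))
    rw [rhs, hΦ.transform, hΦ.apply_eq] at this
    exact this

variable (S Φ q) in
/-- Starting from the state `ξ` at time `a`, the internal dynamics remain bounded by `c₁` under
all continuous outputs that are bounded by `Cy` and compatible with `ξ`. -/
def IsSafe (Cy c₁ a : ℝ) (ξ : X) : Prop :=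
  ∀ y : ℝ → Y, ContinuousOn y (Ici a) → y a = S.h ξ → (∀ t, a ≤ t → ‖y t‖ ≤ Cy) →
    ∃ η : ℝ → Internal X Y, IsGlobalSolution (fun t z => q (y t, z)) a (Φ ξ).2 η ∧
      ∀ t, a ≤ t → ‖η t‖ ≤ c₁

/-- Safety at `a` is applied to the output of `x` followed by `y`; uniqueness identifies the
resulting internal state on `[a, b]` with that of `x`. The bound on the future is thus inherited
from the initial time `a`. -/
theorem IsSafe.exists_extension (hΦ : S.IsByrnesIsidoriForm Φ p q)
    (hs : IsSafe S Φ q Cy c₁ a x₀) (hab : a ≤ b) (hx : IsSolutionOn (S.rhs u) a b x₀ x)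
    (hu : ∀ᵐ t ∂(volume.restrict (Icc a b)), ‖u t‖ ≤ M)
    (hy : ∀ t ∈ Icc a b, ‖S.h (x t)‖ ≤ Cy) {y : ℝ → Y} (hyc : ContinuousOn y (Ici b))
    (hyb : y b = S.h (x b)) (hyC : ∀ t, b ≤ t → ‖y t‖ ≤ Cy) :
    ∃ η : ℝ → Internal X Y, IsGlobalSolution (fun t z => q (y t, z)) b (Φ (x b)).2 η ∧
      (∀ t, a ≤ t → ‖η t‖ ≤ c₁) ∧ ∀ t ∈ Icc a b, η t = (Φ (x t)).2 := by
  classical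
  set w : ℝ → Y := fun t => if t ≤ b then S.h (x t) else y t with hw
  have hw₁ : ∀ t ∈ Icc a b, w t = S.h (x t) := fun t ht => if_pos ht.2
  have hw₂ : ∀ t ∈ Ici b, w t = y t := fun t ht => by
    rcases eq_or_lt_of_le (mem_Ici.1 ht) with h | h
    · rw [← h, hyb]; exact if_pos le_rfl
    · exact if_neg (not_le.2 h)
  have hxc := hx.continuousOn hab
  have hwc : ContinuousOn w (Ici a) := by
    rw [← Icc_union_Ici_eq_Ici hab]
    refine ContinuousOn.union_of_isClosed ?_ ?_ isClosed_Icc isClosed_Ici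
    · exact (S.contDiff_h.continuous.comp_continuousOn hxc).congr hw₁
    · exact hyc.congr hw₂
  obtain ⟨η, hη, hηb⟩ := hs w hwc (by rw [hw₁ a ⟨le_rfl, hab⟩, hx.1]) fun t ht => by
    rcases le_total t b with h | h
    · rw [hw₁ t ⟨ht, h⟩]; exact hy t ⟨ht, h⟩
    · rw [hw₂ t h]; exact hyC t h
  have hηx : ∀ t ∈ Icc a b, η t = (Φ (x t)).2 := by
    have h1 : IsSolutionOn (fun t z => q (w t, z)) a b (Φ x₀).2 η :=
      (hη (b + 1) (by linarith)).mono hab (by linarith)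
    have h2 : IsSolutionOn (fun t z => q (S.h (x t), z)) a b (Φ x₀).2 η := by
      refine h1.congr hab (fun _ _ => rfl) ?_
      filter_upwards [ae_restrict_mem measurableSet_Ioo] with t ht
      simp only [hw₁ t (Ioo_subset_Icc_self ht)]
    exact h2.unique (hΦ.isSolutionOn_internal hab hx hu) hab
      (isLocallyLipschitzField_internal hΦ.contDiff_q hy)
  refine ⟨η, fun b' hb' => ?_, hηb, hηx⟩
  rw [← hηx b ⟨hab, le_rfl⟩]
  refine ((hη b' (hab.trans_lt hb')).tail hab hb'.le).congr hb'.le (fun _ _ => rfl) ?_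
  filter_upwards [ae_restrict_mem measurableSet_Ioo] with t ht
  simp only [hw₂ t (mem_Ici.2 ht.1.le)]

theorem IsSafe.norm_internal_le (hΦ : S.IsByrnesIsidoriForm Φ p q)
    (hs : IsSafe S Φ q Cy c₁ a x₀) (hab : a ≤ b) (hx : IsSolutionOn (S.rhs u) a b x₀ x)
    (hu : ∀ᵐ t ∂(volume.restrict (Icc a b)), ‖u t‖ ≤ M)
    (hy : ∀ t ∈ Icc a b, ‖S.h (x t)‖ ≤ Cy) : ∀ t ∈ Icc a b, ‖(Φ (x t)).2‖ ≤ c₁ := by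
  obtain ⟨η, -, h1, h2⟩ := hs.exists_extension hΦ hab hx hu hy (y := fun _ => S.h (x b))
    continuousOn_const rfl fun t _ => hy b ⟨hab, le_rfl⟩
  intro t ht
  rw [← h2 t ht]
  exact h1 t ht.1

theorem IsSafe.of_trajectory (hΦ : S.IsByrnesIsidoriForm Φ p q)
    (hs : IsSafe S Φ q Cy c₁ a x₀) (hab : a ≤ b) (hx : IsSolutionOn (S.rhs u) a b x₀ x)
    (hu : ∀ᵐ t ∂(volume.restrict (Icc a b)), ‖u t‖ ≤ M)
    (hy : ∀ t ∈ Icc a b, ‖S.h (x t)‖ ≤ Cy) : IsSafe S Φ q Cy c₁ b (x b) := by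
  intro y hyc hyb hyC
  obtain ⟨η, h, h1, -⟩ := hs.exists_extension hΦ hab hx hu hy hyc hyb hyC
  exact ⟨η, h, fun t ht => h1 t (hab.trans ht)⟩

theorem exists_isSafe (hq : IsBIBS (X := X) (Y := Y) q) (hΦ : S.IsByrnesIsidoriForm Φ p q)
    {B : Set X} (hB : Bornology.IsBounded B) (Cy : ℝ) :
    ∃ c₁ : ℝ, 0 < c₁ ∧ ∀ a, 0 ≤ a → ∀ ξ ∈ B, IsSafe S Φ q Cy c₁ a ξ := by
  obtain ⟨R, hR⟩ := hB.exists_norm_le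
  obtain ⟨C, hC0, hC, -⟩ := exists_bound_and_lipschitz_of_contDiff
    (F := fun z => (Φ z).2) hΦ.contDiff_Φ.snd R
  -- `C` bounds the internal states over `B`; the summand `1` only ensures positivity.
  obtain ⟨c₁, hc₁, H⟩ := hq (C + max Cy 0 + 1) (by positivity)
  refine ⟨c₁, hc₁, fun a ha ξ hξ y hyc _ hyC => ?_⟩
  refine H a (Φ ξ).2 y ha (hyc.aestronglyMeasurable measurableSet_Ici) ?_
  have h1 : ‖(Φ ξ).2‖ₑ ≤ ENNReal.ofReal C := by
    rw [← ofReal_norm]; exact ENNReal.ofReal_le_ofReal (hC ξ (hR ξ hξ))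
  have h2 : eLpNorm y ⊤ (volume.restrict (Ici a)) ≤ ENNReal.ofReal (max Cy 0) := by
    rw [eLpNorm_exponent_top]
    refine eLpNormEssSup_le_of_ae_bound ?_
    filter_upwards [ae_restrict_mem measurableSet_Ici] with t ht
    exact (hyC t ht).trans (le_max_left _ _)
  refine (add_le_add h1 h2).trans ?_
  rw [← ENNReal.ofReal_add hC0 (le_max_right _ _)]
  exact ENNReal.ofReal_le_ofReal (by linarith)

/-! ### Feasible controls -/

theorem exists_output_bound (hφ : φ ∈ funnelFunctions) (hyref : MemW1Infty yref) :
    ∃ Cy : ℝ, ∀ t, 0 ≤ t → ∀ y : Y, φ t * ‖y - yref t‖ < 1 → ‖y‖ ≤ Cy := by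
  obtain ⟨-, c, hc, hcφ⟩ := hφ
  obtain ⟨C, -, hC⟩ := hyref.exists_bound
  refine ⟨1 / c + C, fun t ht y hy => ?_⟩
  have h1 : ‖y - yref t‖ ≤ 1 / c := by
    rw [le_div_iff₀ hc]
    nlinarith [mul_le_mul_of_nonneg_right (hcφ t ht) (norm_nonneg (y - yref t))]
  calc ‖y‖ = ‖(y - yref t) + yref t‖ := by rw [sub_add_cancel]
    _ ≤ _ := (norm_add_le _ _).trans (add_le_add h1 (hC t ht))

/-- From every point of the funnel there is a uniformly Lipschitz continuous output along which
`φ ‖y - y_ref‖` is constant. -/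
theorem exists_lipschitz_output (hφ : φ ∈ funnelFunctions) (hyref : MemW1Infty yref) :
    ∃ L : NNReal, ∀ a, 0 ≤ a → ∀ y₀ : Y, φ a * ‖y₀ - yref a‖ < 1 →
      ∃ y : ℝ → Y, LipschitzWith L y ∧ y a = y₀ ∧ ∀ t, a ≤ t → φ t * ‖y t - yref t‖ < 1 := by
  obtain ⟨hφW, c, hc, hcφ⟩ := hφ
  obtain ⟨Lφ, hLφ0, hLφ⟩ := hφW.exists_lipschitz
  obtain ⟨Ly, hLy0, hLy⟩ := hyref.exists_lipschitz
  have hL0 : 0 ≤ Ly + Lφ / (c * c) := by positivity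
  refine ⟨(Ly + Lφ / (c * c)).toNNReal, fun a ha y₀ hy₀ => ?_⟩
  have hpos : ∀ t, 0 ≤ t → 0 < φ t := fun t ht => hc.trans_le (hcφ t ht)
  -- The initial error is rescaled by `φ a / φ t`. Freezing time before `a` makes the output
  -- Lipschitz on all of `ℝ`, with no demand on `φ` and `yref` at negative times.
  refine ⟨fun t => yref (max t a) + (φ a / φ (max t a)) • (y₀ - yref a), ?_, ?_, fun t ht => ?_⟩
  · refine LipschitzWith.of_dist_le_mul fun t s => ?_
    have ht0 : 0 ≤ max t a := ha.trans (le_max_right _ _)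
    have hs0 : 0 ≤ max s a := ha.trans (le_max_right _ _)
    have hmax : |max t a - max s a| ≤ |t - s| := abs_max_sub_max_le_abs t s a
    have hφt := hpos _ ht0
    have hφs := hpos _ hs0
    rw [dist_eq_norm, Real.dist_eq, Real.coe_toNNReal _ hL0, add_mul, add_sub_add_comm, ← sub_smul]
    refine (norm_add_le _ _).trans (add_le_add ?_ ?_)
    · exact (hLy _ _ hs0 ht0).trans (mul_le_mul_of_nonneg_left hmax hLy0)
    · have e : φ a / φ (max t a) - φ a / φ (max s a) =
          φ a * ((φ (max s a) - φ (max t a)) / (φ (max t a) * φ (max s a))) := by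
        field_simp
      have h1 : |φ (max s a) - φ (max t a)| ≤ Lφ * |t - s| := by
        rw [abs_sub_comm]
        exact (hLφ _ _ hs0 ht0).trans (mul_le_mul_of_nonneg_left hmax hLφ0)
      have h2 : c * c ≤ φ (max t a) * φ (max s a) :=
        mul_le_mul (hcφ _ ht0) (hcφ _ hs0) hc.le hφt.le
      rw [norm_smul, Real.norm_eq_abs, e, abs_mul, abs_of_pos (hpos a ha), abs_div,
        abs_of_pos (mul_pos hφt hφs)]
      calc _ = (φ a * ‖y₀ - yref a‖) *
            (|φ (max s a) - φ (max t a)| / (φ (max t a) * φ (max s a))) := by ring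
        _ ≤ 1 * (Lφ * |t - s| / (c * c)) := by
            gcongr
        _ = _ := by ring
  · simp [div_self (hpos a ha).ne']
  · have ht0 : 0 < φ t := hpos t (ha.trans ht)
    simp only [max_eq_left ht, add_sub_cancel_left]
    rw [norm_smul, Real.norm_eq_abs, abs_of_pos (div_pos (hpos a ha) ht0), ← mul_assoc,
      mul_div_cancel₀ _ ht0.ne']
    exact hy₀

theorem continuous_gain_inverse (hS : ∀ x, IsUnit (S.gain x)) :
    Continuous fun x => Ring.inverse (S.gain x) := by
  have hg : Continuous S.gain :=
    (S.contDiff_h.continuous_fderiv two_ne_zero).clm_comp S.contDiff_g.continuous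
  refine continuous_iff_continuousAt.2 fun x => ?_
  have h1 : ContinuousAt Ring.inverse (S.gain x) := by
    obtain ⟨v, hv⟩ := hS x
    rw [← hv]
    exact NormedRing.inverse_continuousAt v
  exact ContinuousAt.comp h1 hg.continuousAt

/-- The transformed trajectory of an output `y` and a corresponding internal state `η` solves
the system under the control `Γ⁻¹ (y' - p(y, η))`. -/
theorem IsByrnesIsidoriForm.isSolutionOn_symm (hΦ : S.IsByrnesIsidoriForm Φ p q)
    (hS : ∀ x, IsUnit (S.gain x)) {L : NNReal} {y : ℝ → Y} {η : ℝ → Internal X Y}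
    (hab : a ≤ b) (hy : LipschitzWith L y) (hyR : ∀ t ∈ Icc a b, ‖y t‖ ≤ Cy)
    (hη : IsSolutionOn (fun t z => q (y t, z)) a b (Φ x₀).2 η) (hy₀ : y a = S.h x₀) :
    IsSolutionOn (S.rhs fun t => Ring.inverse (S.gain (Φ.symm (y t, η t)))
      (deriv y t - p (y t, η t))) a b x₀ fun t => Φ.symm (y t, η t) := by
  obtain ⟨K, hK⟩ := hη.ae_norm_le hab (isLocallyLipschitzField_internal hΦ.contDiff_q hyR)
  obtain ⟨R, hR⟩ := hη.exists_bound hab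
  refine ⟨?_, ?_, ?_⟩
  · simp only [hy₀, hη.1, ← hΦ.apply_eq, Equiv.symm_apply_apply]
  · refine absolutelyContinuousOnInterval_comp (R := max Cy R) (K := max L K)
      (v := fun t => (y t, η t)) hΦ.contDiff_Φ_symm hab (fun s hs t ht => ?_) fun t ht => ?_
    · rw [Prod.mk_sub_mk, Prod.norm_mk, max_mul_of_nonneg _ _ (abs_nonneg _)]
      refine max_le_max ?_ (hη.norm_sub_le hab hK s hs t ht)
      have := hy.dist_le_mul t s
      rwa [dist_eq_norm, Real.dist_eq] at this
    · rw [Prod.norm_mk]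
      exact max_le_max (hyR t ht) (hR t ht)
  · filter_upwards [hη.2.2, ae_restrict_of_ae hy.ae_differentiableAt_real] with t h1 h2
    set ξ := Φ.symm (y t, η t) with hξ
    have hΦξ : Φ ξ = (y t, η t) := Φ.apply_symm_apply _
    have hd : HasFDerivAt Φ (fderiv ℝ Φ ξ) ξ :=
      (hΦ.contDiff_Φ.differentiable one_ne_zero _).hasFDerivAt
    have hd' : HasFDerivAt Φ.symm (fderiv ℝ Φ.symm (y t, η t)) (y t, η t) :=
      (hΦ.contDiff_Φ_symm.differentiable one_ne_zero _).hasFDerivAt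
    -- By the chain rule it then suffices that the derivative of `Φ` sends the right-hand side at
    -- `ξ` to `(y', q(y, η))`, which is the Byrnes-Isidori form with this control.
    have hcomp : ∀ v, fderiv ℝ Φ.symm (y t, η t) (fderiv ℝ Φ ξ v) = v := by
      intro v
      have h3 := (hΦξ ▸ hd' : HasFDerivAt Φ.symm (fderiv ℝ Φ.symm (y t, η t)) (Φ ξ)).comp ξ hd
      have h4 : (Φ.symm ∘ Φ : X → X) = id := by ext; simp
      rw [h4] at h3
      have := h3.unique (hasFDerivAt_id ξ)
      exact DFunLike.congr_fun this v
    have h3 := hd'.comp_hasDerivAt t (h2.hasDerivAt.prodMk h1)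
    convert! h3 using 1
    rw [← hcomp (S.rhs _ t ξ), rhs, hΦ.transform, hΦξ]
    congr 2
    have : S.gain ξ (Ring.inverse (S.gain ξ) (deriv y t - p (y t, η t))) =
        deriv y t - p (y t, η t) := by
      rw [← mul_apply_eq_comp, Ring.mul_inverse_cancel _ (hS ξ)]
      rfl
    rw [this]
    abel

/-- Every safe state in the funnel is the initial state of funnel trajectories, with a uniform
bound on the controls. -/
theorem exists_control_bound (hφ : φ ∈ funnelFunctions) (hyref : MemW1Infty yref)
    (hΦ : S.IsByrnesIsidoriForm Φ p q) (hS : ∀ x, IsUnit (S.gain x))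
    (hCy : ∀ t, 0 ≤ t → ∀ y : Y, φ t * ‖y - yref t‖ < 1 → ‖y‖ ≤ Cy) (c₁ : ℝ) :
    ∃ M : ℝ, 0 < M ∧ ∀ a ξ, 0 ≤ a → ξ ∈ S.funnelStates φ yref a → IsSafe S Φ q Cy c₁ a ξ →
      ∀ b, a ≤ b → ∃ x u, IsFunnelTrajectory S φ yref M a b ξ x u := by
  obtain ⟨L, hL⟩ := exists_lipschitz_output hφ hyref
  have hK := isCompact_closedBall (0 : Y × Internal X Y) (max Cy c₁)
  have hinv := (continuous_gain_inverse hS).comp hΦ.contDiff_Φ_symm.continuous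
  obtain ⟨G, hG⟩ := hK.exists_bound_of_continuousOn hinv.continuousOn
  obtain ⟨P, hP⟩ := hK.exists_bound_of_continuousOn hΦ.contDiff_p.continuous.continuousOn
  -- `G` and `P` bound `Γ⁻¹` and `p` on the ball that contains all the values `(y, η)`, and `L`
  -- bounds `y'`; none of them depends on `a`, `ξ` or `b`.
  refine ⟨|G| * (L + |P|) + 1, by positivity, fun a ξ ha hξ hs b hab => ?_⟩
  obtain ⟨y, hyL, hya, hyf⟩ := hL a ha (S.h ξ) hξ
  have hyC : ∀ t, a ≤ t → ‖y t‖ ≤ Cy := fun t ht => hCy t (ha.trans ht) _ (hyf t ht)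
  obtain ⟨η, hη, hηb⟩ := hs y hyL.continuous.continuousOn hya hyC
  have hηs : IsSolutionOn (fun t z => q (y t, z)) a b (Φ ξ).2 η :=
    (hη (b + 1) (by linarith)).mono hab (by linarith)
  have hsol := hΦ.isSolutionOn_symm hS hab hyL (fun t ht => hyC t ht.1) hηs hya
  refine ⟨_, _, ?_, ?_, hsol, ?_⟩
  · have hηc := hηs.continuousOn hab
    have hpair : ContinuousOn (fun t => (y t, η t)) (Icc a b) :=
      hyL.continuous.continuousOn.prodMk hηc
    refine (ContinuousLinearMap.id ℝ (Y →L[ℝ] Y)).aestronglyMeasurable_comp₂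
      ((hinv.comp_continuousOn hpair).aestronglyMeasurable measurableSet_Icc) ?_
    exact (stronglyMeasurable_deriv y).aestronglyMeasurable.sub
      ((hΦ.contDiff_p.continuous.comp_continuousOn hpair).aestronglyMeasurable measurableSet_Icc)
  · filter_upwards [ae_restrict_mem measurableSet_Icc] with t ht
    have hmem : (y t, η t) ∈ Metric.closedBall (0 : Y × Internal X Y) (max Cy c₁) := by
      rw [mem_closedBall_zero_iff, Prod.norm_mk]
      exact max_le_max (hyC t ht.1) (hηb t ht.1)
    have h1 : ‖deriv y t - p (y t, η t)‖ ≤ L + |P| :=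
      (_root_.norm_sub_le _ _).trans (add_le_add (norm_deriv_le_of_lipschitz hyL)
        ((hP _ hmem).trans (le_abs_self P)))
    have h2 := (hG _ hmem).trans (le_abs_self G)
    refine ((ContinuousLinearMap.le_opNorm _ _).trans
      (mul_le_mul h2 h1 (norm_nonneg _) (abs_nonneg _))).trans ?_
    linarith
  · intro t ht
    have : S.h (Φ.symm (y t, η t)) = y t := by
      rw [← hΦ.fst_eq_output, Equiv.apply_symm_apply]
    rw [ratio, this]
    exact hyf t ht.1

/-- Safety supplies the a priori bound of the direct method: in the coordinates `(y, η)` every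
funnel trajectory stays in a fixed ball, whose image under `Φ⁻¹` is bounded. -/
theorem IsSafe.ocpSolvable (hφ : φ ∈ funnelFunctions) (hyref : MemW1Infty yref)
    (hΦ : S.IsByrnesIsidoriForm Φ p q)
    (hCy : ∀ t, 0 ≤ t → ∀ y : Y, φ t * ‖y - yref t‖ < 1 → ‖y‖ ≤ Cy)
    (hs : IsSafe S Φ q Cy c₁ a x₀) (hlam : 0 ≤ lam) (ha : 0 ≤ a) (hT : 0 ≤ T) (hM : 0 ≤ M)
    (hx₀ : x₀ ∈ S.funnelStates φ yref a)
    (hfeas : ∃ x u, IsFunnelTrajectory S φ yref M a (a + T) x₀ x u) :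
    S.OCPSolvable φ yref lam M T a x₀ := by
  have hab : a ≤ a + T := by linarith
  obtain ⟨R, hR⟩ := (isCompact_closedBall (0 : Y × Internal X Y)
    (max Cy c₁)).exists_bound_of_continuousOn hΦ.contDiff_Φ_symm.continuous.continuousOn
  refine OCPSolvable.of_funnelTrajectory (R := R) hφ hyref hlam ha hT hM hx₀ hfeas
    fun x u h t ht => ?_
  have hy : ∀ t ∈ Icc a (a + T), ‖S.h (x t)‖ ≤ Cy := fun t ht =>
    hCy t (ha.trans ht.1) _ (h.ratio_lt_one t ht)
  have hη := hs.norm_internal_le hΦ hab h.isSolutionOn h.ae_norm_le hy t ht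
  have := hR (Φ (x t)) (by
    rw [mem_closedBall_zero_iff, hΦ.apply_eq, Prod.norm_mk]
    exact max_le_max (hy t ht) hη)
  rwa [Equiv.symm_apply_apply] at this

end ControlSystem

end FunnelMPC

namespace FunnelMPC

/-! ### Gluing across adjacent intervals. -/

theorem ae_restrict_Icc_union {a b c : ℝ} (hab : a ≤ b) (hbc : b ≤ c) {P : ℝ → Prop}
    (h₁ : ∀ᵐ t ∂(volume.restrict (Icc a b)), P t) (h₂ : ∀ᵐ t ∂(volume.restrict (Icc b c)), P t) :
    ∀ᵐ t ∂(volume.restrict (Icc a c)), P t := by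
  rw [← Icc_union_Icc_eq_Icc hab hbc, ae_restrict_union_iff]
  exact ⟨h₁, h₂⟩

theorem IsSolutionOn.trans_of_field {E : Type*} [NormedAddCommGroup E] [NormedSpace ℝ E]
    [FiniteDimensional ℝ E] {F : ℝ → E → E} {a b c : ℝ} {x₀ : E} {x : ℝ → E}
    (h₁ : IsSolutionOn F a b x₀ x) (h₂ : IsSolutionOn F b c (x b) x)
    (hab : a ≤ b) (hbc : b ≤ c) (hF : IsLocallyLipschitzField F a c) :
    IsSolutionOn F a c x₀ x := by
  obtain ⟨C₁, hC₁⟩ := h₁.ae_norm_le hab (hF.mono le_rfl hbc)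
  obtain ⟨C₂, hC₂⟩ := h₂.ae_norm_le hbc (hF.mono hab le_rfl)
  exact h₁.trans h₂ hab hbc (C := max C₁ C₂) (ae_restrict_Icc_union hab hbc
    (hC₁.mono fun _ h => h.trans (le_max_left _ _))
    (hC₂.mono fun _ h => h.trans (le_max_right _ _)))

namespace ControlSystem

variable {X Y : Type*}
  [NormedAddCommGroup X] [NormedSpace ℝ X] [FiniteDimensional ℝ X]
  [NormedAddCommGroup Y] [NormedSpace ℝ Y] [FiniteDimensional ℝ Y]
  {S : ControlSystem X Y} {φ : ℝ → ℝ} {yref : ℝ → Y} {a b c lam M T δ t₀ Cy c₁ : ℝ} {x₀ : X}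
  {x x' : ℝ → X} {u u' : ℝ → Y} {Φ : X ≃ Y × Internal X Y} {p : Y × Internal X Y → Y}
  {q : Y × Internal X Y → Internal X Y}

/-! ### The closed loop -/

theorem IsFunnelTrajectory.of_eqOn (h : IsFunnelTrajectory S φ yref M a c x₀ x u) (hab : a ≤ b)
    (hbc : b ≤ c) (hu : ∀ t ∈ Ico a b, u' t = u t) (hx : IsSolutionOn (S.rhs u') a b x₀ x') :
    IsFunnelTrajectory S φ yref M a b x₀ x' u' := by
  have hsub : Icc a b ⊆ Icc a c := Icc_subset_Icc_right hbc
  have hae : ∀ᵐ t ∂(volume.restrict (Icc a b)), u' t = u t := by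
    refine ae_restrict_Icc_of_Ioo ?_
    filter_upwards [ae_restrict_mem measurableSet_Ioo] with t ht
    exact hu t (Ioo_subset_Ico_self ht)
  have huM := ae_restrict_of_ae_restrict_of_subset hsub h.ae_norm_le
  have hx' : IsSolutionOn (S.rhs u) a b x₀ x' := by
    refine hx.congr hab (fun _ _ => rfl) ?_
    filter_upwards [ae_restrict_Ioo_of_Icc hae] with t ht
    simp only [rhs, ht]
  have heq := hx'.unique (h.isSolutionOn.mono hab hbc) hab (isLocallyLipschitzField_rhs huM)
  refine ⟨(h.aestronglyMeasurable.mono_set hsub).congr ?_, ?_, hx, fun t ht => ?_⟩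
  · filter_upwards [hae] with t ht using ht.symm
  · filter_upwards [hae, huM] with t h1 h2 using by rwa [h1]
  · rw [ratio, heq t ht]
    exact h.ratio_lt_one t (hsub ht)

theorem IsFunnelTrajectory.trans (h₁ : IsFunnelTrajectory S φ yref M a b x₀ x u)
    (h₂ : IsFunnelTrajectory S φ yref M b c (x b) x u) (hab : a ≤ b) (hbc : b ≤ c) :
    IsFunnelTrajectory S φ yref M a c x₀ x u := by
  have hu := ae_restrict_Icc_union hab hbc h₁.ae_norm_le h₂.ae_norm_le
  refine ⟨?_, hu, h₁.isSolutionOn.trans_of_field h₂.isSolutionOn hab hbc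
    (isLocallyLipschitzField_rhs hu), fun t ht => ?_⟩
  · rw [← Icc_union_Icc_eq_Icc hab hbc]
    exact aestronglyMeasurable_union_iff.2 ⟨h₁.aestronglyMeasurable, h₂.aestronglyMeasurable⟩
  · rcases le_total t b with h | h
    · exact h₁.ratio_lt_one t ⟨ht.1, h⟩
    · exact h₂.ratio_lt_one t ⟨h, ht.2⟩

theorem IsFunnelTrajectory.refl (hx : IsSolutionOn (S.rhs u) a a x₀ x)
    (hx₀ : x₀ ∈ S.funnelStates φ yref a) : IsFunnelTrajectory S φ yref M a a x₀ x u := by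
  have h0 : volume.restrict (Icc a a) = 0 := by simp
  refine ⟨by rw [h0]; exact aestronglyMeasurable_zero_measure _, by rw [h0]; simp, hx,
    fun t ht => ?_⟩
  rw [Icc_self, mem_singleton_iff] at ht
  rw [ratio, ht, hx.1]
  exact hx₀

/-- One minimizer of finite cost makes every minimizer have finite cost, so the algorithm may choose
any of them. -/
theorem IsMinimizer.exists_isFunnelTrajectory (hφ : φ ∈ funnelFunctions)
    (hyref : MemW1Infty yref) (hlam : 0 ≤ lam) (ha : 0 ≤ a) (hT : 0 ≤ T) (hM : 0 ≤ M)
    (hx₀ : x₀ ∈ S.funnelStates φ yref a) (hsolv : S.OCPSolvable φ yref lam M T a x₀)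
    (hu : S.IsMinimizer φ yref lam M T a x₀ u) :
    ∃ x, IsFunnelTrajectory S φ yref M a (a + T) x₀ x u := by
  obtain ⟨v, hv, hvc⟩ := hsolv
  have huc : S.cost φ yref lam T a x₀ u ≠ ⊤ :=
    ((hu.2 v hv.1).trans_lt (lt_top_iff_ne_top.2 hvc)).ne
  obtain ⟨x, hx, hr⟩ :=
    exists_funnel_trajectory_of_cost_ne_top hφ hyref hlam ha hT hM hx₀ hu.1 huc
  obtain ⟨hm, huM⟩ := (isAdmissible_iff hM).1 hu.1
  exact ⟨x, hm, huM, hx, hr⟩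

theorem IsFunnelTrajectory.isSafe (h : IsFunnelTrajectory S φ yref M a b x₀ x u)
    (hΦ : S.IsByrnesIsidoriForm Φ p q)
    (hCy : ∀ t, 0 ≤ t → ∀ y : Y, φ t * ‖y - yref t‖ < 1 → ‖y‖ ≤ Cy)
    (ha : 0 ≤ a) (hab : a ≤ b) (hs : IsSafe S Φ q Cy c₁ a x₀) :
    x b ∈ S.funnelStates φ yref b ∧ IsSafe S Φ q Cy c₁ b (x b) :=
  ⟨h.ratio_lt_one b ⟨hab, le_rfl⟩, hs.of_trajectory hΦ hab h.isSolutionOn h.ae_norm_le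
    fun t ht => hCy t (ha.trans ht.1) _ (h.ratio_lt_one t ht)⟩

theorem IsRun.of_succ {N : ℕ} (hδ : 0 ≤ δ)
    (h : S.IsRun φ yref lam M T δ t₀ x₀ (N + 1) x u) : S.IsRun φ yref lam M T δ t₀ x₀ N x u := by
  refine ⟨h.1.mono ?_ ?_, fun k hk => h.2 k (hk.trans N.lt_succ_self)⟩
  · have : 0 ≤ (N : ℝ) * δ := by positivity
    linarith
  · push_cast; nlinarith

/-- At each sampling instant the state is in the funnel and safe, so whichever minimizer was applied
keeps the next piece in the funnel; uniqueness identifies that piece with the given run. -/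
theorem IsRun.isFunnelTrajectory {N : ℕ} (hφ : φ ∈ funnelFunctions) (hyref : MemW1Infty yref)
    (hΦ : S.IsByrnesIsidoriForm Φ p q)
    (hCy : ∀ t, 0 ≤ t → ∀ y : Y, φ t * ‖y - yref t‖ < 1 → ‖y‖ ≤ Cy)
    (hlam : 0 ≤ lam) (hδ : 0 < δ) (hδT : δ ≤ T) (hM : 0 ≤ M) (ht₀ : 0 ≤ t₀)
    (hx₀ : x₀ ∈ S.funnelStates φ yref t₀) (hs : IsSafe S Φ q Cy c₁ t₀ x₀)
    (hsolv : ∀ a ξ, 0 ≤ a → ξ ∈ S.funnelStates φ yref a → IsSafe S Φ q Cy c₁ a ξ →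
      S.OCPSolvable φ yref lam M T a ξ)
    (h : S.IsRun φ yref lam M T δ t₀ x₀ N x u) :
    IsFunnelTrajectory S φ yref M t₀ (t₀ + N * δ) x₀ x u := by
  induction N with
  | zero =>
    have h1 := h.1
    simp only [Nat.cast_zero, zero_mul, add_zero] at h1 ⊢
    exact IsFunnelTrajectory.refl h1 hx₀
  | succ N ih =>
    have hrun := h.of_succ hδ.le
    have htr := ih hrun
    have hNδ : 0 ≤ (N : ℝ) * δ := by positivity
    have hle : t₀ ≤ t₀ + N * δ := by linarith
    have hle' : t₀ + N * δ ≤ t₀ + ((N + 1 : ℕ) : ℝ) * δ := by push_cast; nlinarith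
    have ha : 0 ≤ t₀ + N * δ := by linarith
    obtain ⟨hfun, hsafe⟩ := htr.isSafe hΦ hCy ht₀ hle hs
    obtain ⟨v, hv, hvu⟩ := h.2 N N.lt_succ_self
    obtain ⟨y, hy⟩ := hv.exists_isFunnelTrajectory hφ hyref hlam ha (hδ.le.trans hδT) hM hfun
      (hsolv _ _ ha hfun hsafe)
    refine htr.trans (hy.of_eqOn hle' ?_ ?_ (h.1.tail hle hle')) hle hle'
    · push_cast; linarith
    · exact fun t ht => hvu t (by push_cast at ht; exact ht)

theorem IsClosedLoop.isRun (hδ : 0 < δ) (h : S.IsClosedLoop φ yref lam M T δ t₀ x₀ x u) (N : ℕ) :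
    S.IsRun φ yref lam M T δ t₀ x₀ N x u := by
  have hNδ : 0 ≤ (N : ℝ) * δ := by positivity
  exact ⟨(h.1 (t₀ + N * δ + 1) (by linarith)).mono (by linarith) (by linarith),
    fun k _ => h.2 k⟩

theorem exists_le_add_mul (hδ : 0 < δ) (t₀ t : ℝ) : ∃ N : ℕ, t ≤ t₀ + N * δ := by
  obtain ⟨N, hN⟩ := exists_nat_ge ((t - t₀) / δ)
  rw [div_le_iff₀ hδ] at hN
  exact ⟨N, by linarith⟩

theorem isClosedLoop_of_isRun (hδ : 0 < δ)
    (h : ∀ N, S.IsRun φ yref lam M T δ t₀ x₀ N x u) :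
    S.IsClosedLoop φ yref lam M T δ t₀ x₀ x u := by
  refine ⟨fun b hb => ?_, fun k => (h (k + 1)).2 k k.lt_succ_self⟩
  obtain ⟨N, hN⟩ := exists_le_add_mul hδ t₀ b
  exact (h N).1.mono hb.le hN

/-- If in every state of a set `G` that is invariant under optimal trajectories there is an
optimal control, then the optimal pieces can be glued to a closed loop trajectory. -/
theorem exists_isClosedLoop (hδ : 0 < δ) (hδT : δ ≤ T) (ht₀ : 0 ≤ t₀) {G : ℝ → X → Prop}
    (hG₀ : G t₀ x₀)
    (hG : ∀ a ξ, 0 ≤ a → G a ξ → ∃ u x, S.IsMinimizer φ yref lam M T a ξ u ∧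
      IsFunnelTrajectory S φ yref M a (a + T) ξ x u ∧ G (a + δ) (x (a + δ))) :
    ∃ x u, S.IsClosedLoop φ yref lam M T δ t₀ x₀ x u := by
  choose! U Z hmin htraj hnext using hG
  -- The states at the sampling instants are generated first; trajectory and input are then read off
  -- from the piece with index `κ t`.
  let ξ : ℕ → X := fun k => Nat.rec x₀
    (fun k z => Z (t₀ + k * δ) z (t₀ + k * δ + δ)) k
  have hξ : ∀ k : ℕ, ξ (k + 1) = Z (t₀ + k * δ) (ξ k) (t₀ + k * δ + δ) := fun k => rfl
  have hsucc : ∀ k : ℕ, t₀ + ((k + 1 : ℕ) : ℝ) * δ = t₀ + k * δ + δ := fun k => by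
    push_cast; ring
  have hk0 : ∀ k : ℕ, 0 ≤ (k : ℝ) * δ := fun k => by positivity
  have hGk : ∀ k : ℕ, G (t₀ + k * δ) (ξ k) := by
    intro k
    induction k with
    | zero => simpa [ξ] using hG₀
    | succ k ih =>
      rw [hsucc, hξ]
      exact hnext _ _ (by linarith [hk0 k]) ih
  have htr := fun k : ℕ => htraj _ _ (by linarith [hk0 k]) (hGk k)
  have hmn := fun k : ℕ => hmin _ _ (by linarith [hk0 k]) (hGk k)
  set κ : ℝ → ℕ := fun t => ⌊(t - t₀) / δ⌋₊ with hκ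
  have hκeq : ∀ k : ℕ, ∀ t ∈ Ico (t₀ + k * δ) (t₀ + k * δ + δ), κ t = k := fun k t ht => by
    have h0 : 0 ≤ (t - t₀) / δ := div_nonneg (by linarith [hk0 k, ht.1]) hδ.le
    rw [hκ, Nat.floor_eq_iff h0, le_div_iff₀ hδ, div_lt_iff₀ hδ]
    constructor
    · linarith [ht.1]
    · linarith [ht.2]
  let x : ℝ → X := fun t => Z (t₀ + κ t * δ) (ξ (κ t)) t
  let u : ℝ → Y := fun t => U (t₀ + κ t * δ) (ξ (κ t)) t
  have hxk : ∀ k : ℕ, x (t₀ + k * δ) = ξ k := fun k => by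
    have : κ (t₀ + k * δ) = k := hκeq k _ ⟨le_rfl, by linarith⟩
    simp only [x, this]
    exact (htr k).isSolutionOn.1
  -- At the right endpoint `x` already uses the next piece, which starts where this one ends.
  have hxI : ∀ k : ℕ, ∀ t ∈ Icc (t₀ + k * δ) (t₀ + k * δ + δ),
      Z (t₀ + k * δ) (ξ k) t = x t := fun k t ht => by
    rcases eq_or_lt_of_le ht.2 with h | h
    · rw [h, ← hξ, ← hsucc, hxk]
    · simp only [x, hκeq k t ⟨ht.1, h⟩]
  have huI : ∀ k : ℕ, ∀ t ∈ Ico (t₀ + k * δ) (t₀ + k * δ + δ),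
      u t = U (t₀ + k * δ) (ξ k) t := fun k t ht => by
    simp only [u, hκeq k t ht]
  have hsol : ∀ k : ℕ, IsSolutionOn (S.rhs u) (t₀ + k * δ) (t₀ + k * δ + δ) (ξ k) x := fun k => by
    refine ((htr k).isSolutionOn.mono (c := t₀ + k * δ + δ) (by linarith) (by linarith)).congr
      (by linarith) (hxI k) ?_
    filter_upwards [ae_restrict_mem measurableSet_Ioo] with t ht
    simp only [rhs, huI k t (Ioo_subset_Ico_self ht)]
  have hft : ∀ k : ℕ,
      IsFunnelTrajectory S φ yref M (t₀ + k * δ) (t₀ + k * δ + δ) (ξ k) x u := fun k =>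
    (htr k).of_eqOn (by linarith) (by linarith) (huI k) (hsol k)
  have hall : ∀ N : ℕ, IsFunnelTrajectory S φ yref M t₀ (t₀ + (N + 1 : ℕ) * δ) x₀ x u := by
    intro N
    induction N with
    | zero => simpa [ξ] using hft 0
    | succ N ih =>
      rw [hsucc (N + 1)]
      refine ih.trans ?_ (by linarith [hk0 (N + 1)]) (by linarith)
      rw [hxk]
      exact hft (N + 1)
  refine ⟨x, u, isClosedLoop_of_isRun hδ fun N => ⟨(hall N).isSolutionOn.mono
    (by linarith [hk0 N]) (by rw [hsucc]; linarith), fun k _ => ?_⟩⟩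
  refine ⟨U (t₀ + k * δ) (ξ k), ?_, fun t ht => huI k t ?_⟩
  · rw [hxk]; exact hmn k
  · convert! ht using 2
    ring

end ControlSystem

end FunnelMPC

/-! ### The main theorem. -/

theorem mainTheorem1
    {X Y : Type*}
    [NormedAddCommGroup X] [NormedSpace ℝ X] [FiniteDimensional ℝ X]
    [NormedAddCommGroup Y] [NormedSpace ℝ Y] [FiniteDimensional ℝ Y]
    (S : FunnelMPC.ControlSystem X Y) (hS : S.MemClassN)
    (φ : ℝ → ℝ) (hφ : φ ∈ FunnelMPC.funnelFunctions)
    (yref : ℝ → Y) (hyref : FunnelMPC.MemW1Infty yref)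
    (t₀ : ℝ) (ht₀ : 0 ≤ t₀)
    (B : Set X) (hB : Bornology.IsBounded B) (hBD : B ⊆ S.funnelStates φ yref t₀) :
    ∃ M : ℝ, 0 < M ∧
      ∀ lam T δ : ℝ, 0 ≤ lam → 0 < δ → δ ≤ T → ∀ x₀ ∈ B,
        -- initial feasibility
        S.OCPSolvable φ yref lam M T t₀ x₀ ∧
        -- recursive feasibility
        (∀ (N : ℕ) (x : ℝ → X) (u : ℝ → Y),
          S.IsRun φ yref lam M T δ t₀ x₀ N x u →
            S.OCPSolvable φ yref lam M T (t₀ + N * δ) (x (t₀ + N * δ))) ∧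
        -- existence of a global solution of the closed loop
        (∃ (x : ℝ → X) (u : ℝ → Y), S.IsClosedLoop φ yref lam M T δ t₀ x₀ x u) ∧
        -- properties of every global solution of the closed loop
        (∀ (x : ℝ → X) (u : ℝ → Y), S.IsClosedLoop φ yref lam M T δ t₀ x₀ x u →
          (∀ᵐ t ∂(volume.restrict (Ici t₀)), ‖u t‖ ≤ M) ∧
          ∀ t : ℝ, t₀ ≤ t →
            (t, S.h (x t) - yref t) ∈ FunnelMPC.funnel Y φ ∧
            ‖S.h (x t) - yref t‖ ≤ (φ t)⁻¹) := by
  obtain ⟨Φ, p, q, hΦ, hq⟩ := hS.bibs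
  -- The constants are fixed in the order `Cy`, `c₁`, `M`, before `lam`, `T`, `δ` and `x₀` appear.
  obtain ⟨Cy, hCy⟩ := FunnelMPC.ControlSystem.exists_output_bound hφ hyref
  obtain ⟨c₁, -, hsafe⟩ := FunnelMPC.ControlSystem.exists_isSafe hq hΦ hB Cy
  obtain ⟨M, hM, hctrl⟩ :=
    FunnelMPC.ControlSystem.exists_control_bound hφ hyref hΦ hS.relDegreeOne hCy c₁
  refine ⟨M, hM, fun lam T δ hlam hδ hδT x₀ hx₀ => ?_⟩
  have hT : 0 ≤ T := hδ.le.trans hδT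
  have hfun₀ := hBD hx₀
  have hsafe₀ := hsafe t₀ ht₀ x₀ hx₀
  have hsolv : ∀ a ξ, 0 ≤ a → ξ ∈ S.funnelStates φ yref a →
      FunnelMPC.ControlSystem.IsSafe S Φ q Cy c₁ a ξ → S.OCPSolvable φ yref lam M T a ξ :=
    fun a ξ ha hξ hs => hs.ocpSolvable hφ hyref hΦ hCy hlam ha hT hM.le hξ
      (hctrl a ξ ha hξ hs _ (by linarith))
  have hN : ∀ N : ℕ, t₀ ≤ t₀ + N * δ := fun N => by
    have : 0 ≤ (N : ℝ) * δ := by positivity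
    linarith
  have hrun : ∀ (N : ℕ) (x : ℝ → X) (u : ℝ → Y), S.IsRun φ yref lam M T δ t₀ x₀ N x u →
      FunnelMPC.ControlSystem.IsFunnelTrajectory S φ yref M t₀ (t₀ + N * δ) x₀ x u :=
    fun N x u h => h.isFunnelTrajectory hφ hyref hΦ hCy hlam hδ hδT hM.le ht₀ hfun₀ hsafe₀ hsolv
  refine ⟨hsolv t₀ x₀ ht₀ hfun₀ hsafe₀, fun N x u h => ?_, ?_, fun x u h => ⟨?_, fun t ht => ?_⟩⟩
  · obtain ⟨h1, h2⟩ := (hrun N x u h).isSafe hΦ hCy ht₀ (hN N) hsafe₀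
    exact hsolv _ _ (ht₀.trans (hN N)) h1 h2
  · refine FunnelMPC.ControlSystem.exists_isClosedLoop (M := M) hδ hδT ht₀
      (G := fun a ξ => ξ ∈ S.funnelStates φ yref a ∧
        FunnelMPC.ControlSystem.IsSafe S Φ q Cy c₁ a ξ) ⟨hfun₀, hsafe₀⟩ fun a ξ ha hG => ?_
    have hsol := hsolv a ξ ha hG.1 hG.2
    obtain ⟨u, hu, -⟩ := id hsol
    obtain ⟨x, hx⟩ := hu.exists_isFunnelTrajectory hφ hyref hlam ha hT hM.le hG.1 hsol
    refine ⟨u, x, hu, hx, ?_⟩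
    have hx' := hx.of_eqOn (b := a + δ) (by linarith) (by linarith) (fun _ _ => rfl)
      (hx.isSolutionOn.mono (by linarith) (by linarith))
    exact hx'.isSafe hΦ hCy ha (by linarith) hG.2
  -- A countable cover turns the bounds on finite runs into one almost everywhere bound.
  · have hcover : Ici t₀ ⊆ ⋃ N : ℕ, Icc t₀ (t₀ + N * δ) := fun t ht => by
      obtain ⟨N, hNt⟩ := FunnelMPC.ControlSystem.exists_le_add_mul hδ t₀ t
      exact mem_iUnion.2 ⟨N, ht, hNt⟩
    refine ae_restrict_of_ae_restrict_of_subset hcover ?_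
    rw [ae_restrict_iUnion_iff]
    exact fun N => (hrun N x u (h.isRun hδ N)).ae_norm_le
  · obtain ⟨N, hNt⟩ := FunnelMPC.ControlSystem.exists_le_add_mul hδ t₀ t
    have hr : φ t * ‖S.h (x t) - yref t‖ < 1 :=
      (hrun N x u (h.isRun hδ N)).ratio_lt_one t ⟨ht, hNt⟩
    have ht' : 0 ≤ t := ht₀.trans ht
    obtain ⟨c, hc, hcφ⟩ := hφ.2
    have hφt : 0 < φ t := hc.trans_le (hcφ t ht')
    refine ⟨⟨ht', hr⟩, ?_⟩
    rw [inv_eq_one_div, le_div_iff₀ hφt, mul_comm]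
    exact hr.le
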